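/- **Theorem 3.1.** Let $Y=(Y_s)_{s\ge 0}$ be a standard one-dimensional Brownian motion started at $0$ and, for an open interval $I\subseteq\mathbb{R}$, let $\eta_I=\inf\{s\ge 0: Y_s\notin I\}\in[0,\infty]$ (with $\inf\emptyset=\infty$) be its first exit time from $I$. Let $\xi$ be a positive random variable with a density $f$ such that, for some constants $C>0$ and $p>0$, $$\lim_{t\to\infty}\frac{f(t)}{C\,t^{-p-1}}=1 .$$ Let $\xi_1,\xi_2$ be independent copies of $\xi$ such that the pair $(\xi_1,\xi_2)$ is independent of $Y$. Then, as $t\to\infty$, $$P\big(\eta_{(-\xi_1,\xi_2)}>t\big)\approx\begin{cases} t^{-p}, & p<1,\\ t^{-1}\ln t, & p=1,\\ t^{-(p+1)/2}, & p>1,\end{cases}$$ where $g\approx h$ as $t\to\infty$ means that there are constants $C_1,C_2>0$ such that $C_1\le g(t)/h(t)\le C_2$ for all sufficiently large $t$. -/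

import Mathlib

open MeasureTheory ProbabilityTheory Filter
open scoped NNReal ENNReal

/-- The first exit time `inf {t ≥ 0 : y t ∉ I}` of a path `y : [0, ∞) → ℝ` from a set `I`, as an
element of `[0, ∞]`; it is `∞` if the path never leaves `I`. -/
noncomputable def exitTime (y : ℝ≥0 → ℝ) (I : Set ℝ) : ℝ≥0∞ :=
  sInf ((fun t : ℝ≥0 => (t : ℝ≥0∞)) '' {t : ℝ≥0 | y t ∉ I})

/-- `f ≈ g` as `t → ∞`: there are positive constants `C₁`, `C₂` with `C₁ ≤ f t / g t ≤ C₂` for all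
sufficiently large `t`. -/
def ApproxAtTop (f g : ℝ → ℝ) : Prop :=
  ∃ C₁ C₂ : ℝ, 0 < C₁ ∧ 0 < C₂ ∧ ∀ᶠ t in atTop, C₁ ≤ f t / g t ∧ f t / g t ≤ C₂

/-- `f ~ g` as `t → ∞`: the quotient `f t / g t` tends to `1`. -/
def SimAtTop (f g : ℝ → ℝ) : Prop :=
  Tendsto (fun t => f t / g t) atTop (nhds 1)

/-- `P(η_{(-a, b)} > t)`: the probability that the exit time of the process `Y` from the open
interval `(-a, b)` with random end points exceeds `t`. -/
noncomputable def exitTail {Ω : Type*} [MeasurableSpace Ω] (P : Measure Ω)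
    (Y : ℝ≥0 → Ω → ℝ) (a b : Ω → ℝ) (t : ℝ) : ℝ :=
  P.real {ω | ENNReal.ofReal t < exitTime (fun s => Y s ω) (Set.Ioo (-a ω) (b ω))}

/-! Fix end points `a`, `b` and put T = √t. To survive in (-a, b) until time t, the path must avoid
the nearer end point, which costs a factor of order min(1, a/T) when `a ≤ b`. If the farther end
point is also much closer than T, survival costs a further factor smaller than any power of b/T.
Conversely, if `b` is at least T, the first factor alone is attained up to a constant. Both bounds
are in `IsBrownianReal.exists_measureReal_confined_le` and `IsBrownianReal.le_measureReal_confined`.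

Averaging over independent end points with law μ bounds the exit tail above by a multiple of E
min(1, ξ/T) · E min(1, (ξ/T)^(2K)), and below by a multiple of E min(1, ξ/T) · μ(2T, ∞)
(`exists_exitTail_le`, `le_exitTail`). For 2K > p the second factors are both of order T^(-p). The
first factor decides the regime: it is of order T^(-p), T^(-1) log T or T^(-1) for p < 1, p = 1 or p
> 1. Substituting T = √t gives the three rates.

The Brownian estimates come from Gaussian walks on finer and finer grids, using that sine functions
are eigenfunctions of the Gaussian kernel. A sine vanishing at both ends of a unit interval gives
the lower bound. A superharmonic barrier gives the linear upper bound in `a`, up to errors from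
large jumps that vanish with the mesh. The extra decay in `b` comes from independent increments over
blocks of length at least b², each of which must be small. -/

/-- A random walk started at `0` whose steps are centered Gaussian of variance `h` and independent
of the past. -/
structure IsGaussianWalk {Ω : Type*} [MeasurableSpace Ω] (S : ℕ → Ω → ℝ) (h : ℝ≥0)
    (P : Measure Ω) : Prop where
  measurable : ∀ k, Measurable (S k)
  zero : ∀ᵐ ω ∂P, S 0 ω = 0
  law : ∀ k, HasLaw (fun ω => S (k + 1) ω - S k ω) (gaussianReal 0 h) P
  indep : ∀ k, IndepFun (fun ω => S (k + 1) ω - S k ω) (fun ω (i : Set.Iic k) => S i ω) P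

/-- The event that the process `S` stays in `J` up to time `k`. -/
def stayIn {Ω : Type*} (S : ℕ → Ω → ℝ) (J : Set ℝ) (k : ℕ) : Set Ω :=
  {ω | ∀ i ≤ k, S i ω ∈ J}

/-! ### Trigonometric integrals and tails of a centered Gaussian -/

lemma integral_cexp_gaussianReal (h : ℝ≥0) (θ : ℝ) :
    ∫ x, Complex.exp ((θ * x : ℝ) * Complex.I) ∂(gaussianReal 0 h)
      = (Real.exp (-(θ ^ 2 * h / 2)) : ℝ) := by
  have := charFun_gaussianReal (μ := 0) (v := h) θ
  rw [charFun_apply_real] at this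
  push_cast
  rw [this]
  congr 1
  simp
  ring

lemma integral_cos_gaussianReal (h : ℝ≥0) (θ : ℝ) :
    ∫ x, Real.cos (θ * x) ∂(gaussianReal 0 h) = Real.exp (-(θ ^ 2 * h / 2)) := by
  have hint : Integrable (fun x : ℝ => Complex.exp ((θ * x : ℝ) * Complex.I)) (gaussianReal 0 h) := by
    refine Integrable.of_bound (by fun_prop) 1 (ae_of_all _ fun x => ?_)
    rw [Complex.norm_exp_ofReal_mul_I]
  have := congrArg Complex.re (integral_cexp_gaussianReal h θ)
  rw [Complex.ofReal_re] at this
  rw [← this, ← RCLike.re_eq_complex_re, ← integral_re hint]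
  simp only [RCLike.re_eq_complex_re, Complex.exp_ofReal_mul_I_re]

lemma integral_sin_gaussianReal (h : ℝ≥0) (θ : ℝ) :
    ∫ x, Real.sin (θ * x) ∂(gaussianReal 0 h) = 0 := by
  have hint : Integrable (fun x : ℝ => Complex.exp ((θ * x : ℝ) * Complex.I)) (gaussianReal 0 h) := by
    refine Integrable.of_bound (by fun_prop) 1 (ae_of_all _ fun x => ?_)
    rw [Complex.norm_exp_ofReal_mul_I]
  have := congrArg Complex.im (integral_cexp_gaussianReal h θ)
  rw [Complex.ofReal_im] at this
  refine Eq.trans ?_ this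
  rw [← RCLike.im_eq_complex_im, ← integral_im hint]
  simp only [RCLike.im_eq_complex_im, Complex.exp_ofReal_mul_I_im]

lemma gaussianReal_measureReal_ge_le (h : ℝ≥0) {δ : ℝ} (hδ : 0 ≤ δ) :
    (gaussianReal 0 h).real {x | δ ≤ |x|} ≤ 2 * Real.exp (-δ ^ 2 / (2 * h)) := by
  have key : ∀ {X : ℝ → ℝ}, (gaussianReal 0 h).map X = gaussianReal 0 h → Measurable X →
      (gaussianReal 0 h).real {x | δ ≤ X x} ≤ Real.exp (-δ ^ 2 / (2 * h)) := by
    intro X hX hm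
    have : HasSubgaussianMGF X h (gaussianReal 0 h) := by
      refine ⟨fun t => ?_, fun t => ?_⟩
      · have := integrable_exp_mul_gaussianReal (μ := 0) (v := h) t
        rw [← hX] at this
        exact this.comp_measurable hm
      · rw [mgf_gaussianReal hX]; simp
    exact this.measure_ge_le hδ
  have h1 := key (X := id) (by simp) measurable_id
  have h2 := key (X := fun x => -x) (by rw [gaussianReal_map_neg]; simp) measurable_neg
  have h3 : {x : ℝ | δ ≤ |x|} ⊆ {x | δ ≤ id x} ∪ {x | δ ≤ -x} := by
    intro x hx
    simpa [le_abs] using hx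
  calc _ ≤ _ := measureReal_mono h3
    _ ≤ _ := measureReal_union_le _ _
    _ ≤ _ := by linarith

/-! ### Gaussian walks restricted to a set: one-step identities -/

namespace IsGaussianWalk

variable {Ω : Type*} [MeasurableSpace Ω] {P : Measure Ω}
  {S : ℕ → Ω → ℝ} {h : ℝ≥0} {J : Set ℝ}

lemma measurableSet_stayIn (hS : IsGaussianWalk S h P) (hJ : MeasurableSet J) (k : ℕ) :
    MeasurableSet (stayIn S J k) := by
  simp only [stayIn, Set.ofPred_forall]
  exact MeasurableSet.iInter fun i => MeasurableSet.iInter fun _ => hS.measurable i hJ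

omit [MeasurableSpace Ω] in
lemma stayIn_succ (S : ℕ → Ω → ℝ) (J : Set ℝ) (k : ℕ) :
    stayIn S J (k + 1) = stayIn S J k ∩ {ω | S (k + 1) ω ∈ J} := by
  ext ω
  simp [stayIn, Nat.le_succ_iff, or_imp, forall_and]

/-- The event and the current position are both functions of the path up to time `k`, hence
independent of the next step, so the expectation factorises. -/
lemma setIntegral_mul_step [IsProbabilityMeasure P] (hS : IsGaussianWalk S h P) (hJ : MeasurableSet J) (k : ℕ)
    {u v : ℝ → ℝ} (hu : Measurable u) (hv : Measurable v) :
    ∫ ω in stayIn S J k, u (S k ω) * v (S (k + 1) ω - S k ω) ∂P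
      = (∫ ω in stayIn S J k, u (S k ω) ∂P) * ∫ x, v x ∂(gaussianReal 0 h) := by
  classical
  let E : Set (Set.Iic k → ℝ) := {w | ∀ i, w i ∈ J}
  have hE : MeasurableSet E := by
    simp only [E, Set.ofPred_forall]
    exact MeasurableSet.iInter fun i => measurable_pi_apply i hJ
  let U : (Set.Iic k → ℝ) → ℝ := E.indicator fun w => u (w ⟨k, Set.mem_Iic.2 le_rfl⟩)
  have hU : Measurable U := (hu.comp (measurable_pi_apply _)).indicator hE
  have hA := hS.measurableSet_stayIn hJ k
  have hUeq : ∀ ω, U (fun i : Set.Iic k => S i ω) = (stayIn S J k).indicator (fun ω => u (S k ω)) ω := by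
    intro ω
    have : ((fun i : Set.Iic k => S i ω) ∈ E) ↔ ω ∈ stayIn S J k := by
      simp [E, stayIn]
    by_cases hω : ω ∈ stayIn S J k
    · rw [Set.indicator_of_mem hω]; exact Set.indicator_of_mem (this.2 hω) _
    · rw [Set.indicator_of_notMem hω]; exact Set.indicator_of_notMem (fun h => hω (this.1 h)) _
  have hm1 : Measurable fun ω => S (k + 1) ω - S k ω := (hS.measurable _).sub (hS.measurable _)
  have hm2 : Measurable fun ω (i : Set.Iic k) => S i ω :=
    measurable_pi_lambda _ fun i => hS.measurable _
  have hind : IndepFun (fun ω => U (fun i : Set.Iic k => S i ω))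
      (fun ω => v (S (k + 1) ω - S k ω)) P := ((hS.indep k).comp hv hU).symm
  have := hind.integral_fun_mul_eq_mul_integral (hU.comp hm2).aestronglyMeasurable
    (hv.comp hm1).aestronglyMeasurable
  rw [← (hS.law k).integral_comp hv.aestronglyMeasurable, ← integral_indicator hA,
    ← integral_indicator hA]
  simp only [hUeq] at this
  simp only [Function.comp_def]
  rw [← this]
  refine integral_congr_ae (ae_of_all _ fun ω => ?_)
  by_cases hω : ω ∈ stayIn S J k <;> simp [hω]

/-- The functions `sin (θ x + c)` are eigenfunctions of the transition kernel of the walk. -/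
lemma setIntegral_sin_succ [IsProbabilityMeasure P] (hS : IsGaussianWalk S h P) (hJ : MeasurableSet J) (k : ℕ) (θ c : ℝ) :
    ∫ ω in stayIn S J k, Real.sin (θ * S (k + 1) ω + c) ∂P
      = Real.exp (-(θ ^ 2 * h / 2)) * ∫ ω in stayIn S J k, Real.sin (θ * S k ω + c) ∂P := by
  have hm1 : Measurable fun ω => S (k + 1) ω - S k ω := (hS.measurable _).sub (hS.measurable _)
  have hSk := hS.measurable k
  have h1 := hS.setIntegral_mul_step hJ k (u := fun x => Real.sin (θ * x + c))
    (v := fun x => Real.cos (θ * x)) (by fun_prop) (by fun_prop)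
  have h2 := hS.setIntegral_mul_step hJ k (u := fun x => Real.cos (θ * x + c))
    (v := fun x => Real.sin (θ * x)) (by fun_prop) (by fun_prop)
  rw [integral_cos_gaussianReal] at h1
  -- Of the two terms of the addition formula, only the one with the cosine of the step survives.
  rw [integral_sin_gaussianReal, mul_zero] at h2
  have bd : ∀ x y : ℝ, |x| ≤ 1 → |y| ≤ 1 → ‖x * y‖ ≤ 1 := fun x y hx hy => by
    rw [Real.norm_eq_abs, abs_mul]; exact mul_le_one₀ hx (abs_nonneg _) hy
  have hadd : ∀ ω, Real.sin (θ * S (k + 1) ω + c)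
      = Real.sin (θ * S k ω + c) * Real.cos (θ * (S (k + 1) ω - S k ω))
        + Real.cos (θ * S k ω + c) * Real.sin (θ * (S (k + 1) ω - S k ω)) := by
    intro ω
    rw [← Real.sin_add]; congr 1; ring
  simp only [hadd]
  rw [integral_add, h1, h2, add_zero, mul_comm]
  · refine Integrable.of_bound (by fun_prop) 1 (ae_of_all _ fun x => ?_)
    exact bd _ _ (Real.abs_sin_le_one _) (Real.abs_cos_le_one _)
  · refine Integrable.of_bound (by fun_prop) 1 (ae_of_all _ fun x => ?_)
    exact bd _ _ (Real.abs_cos_le_one _) (Real.abs_sin_le_one _)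

lemma measureReal_step (hS : IsGaussianWalk S h P) (k : ℕ) (δ : ℝ) :
    P.real {ω | δ ≤ |S (k + 1) ω - S k ω|} = (gaussianReal 0 h).real {x | δ ≤ |x|} :=
  (hS.law k).measureReal_eq (p := fun x => δ ≤ |x|) (measurableSet_le (by fun_prop) (by fun_prop))

end IsGaussianWalk

/-! ### Staying probabilities of Gaussian walks: sine lower bound and barrier upper bound -/

namespace IsGaussianWalk

variable {Ω : Type*} [MeasurableSpace Ω] {P : Measure Ω} [IsProbabilityMeasure P]
  {S : ℕ → Ω → ℝ} {h : ℝ≥0}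

/-- The sine has period two and vanishes at both ends of the unit interval, so it is nonpositive on
the two adjacent unit intervals. A jump shorter than one cannot pass beyond these. -/
lemma sin_le_indicator_add_indicator {a x y : ℝ} (hx : x ∈ Set.Ioo (-a) (1 - a)) :
    Real.sin (Real.pi * y + Real.pi * a)
      ≤ (Set.Ioo (-a) (1 - a)).indicator (fun y => Real.sin (Real.pi * y + Real.pi * a)) y
        + {z : ℝ | 1 ≤ |z|}.indicator 1 (y - x) := by
  have hpi := Real.pi_pos
  obtain ⟨hx1, hx2⟩ := hx
  by_cases hy : y ∈ Set.Ioo (-a) (1 - a)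
  · rw [Set.indicator_of_mem hy]
    have : (0 : ℝ) ≤ {z : ℝ | 1 ≤ |z|}.indicator 1 (y - x) :=
      Set.indicator_nonneg (fun _ _ => zero_le_one) _
    linarith
  rw [Set.indicator_of_notMem hy, zero_add]
  by_cases hz : 1 ≤ |y - x|
  · rw [Set.indicator_of_mem (by exact hz)]
    exact Real.sin_le_one _
  rw [Set.indicator_of_notMem (by exact hz)]
  rw [not_le, abs_lt] at hz
  rw [Set.mem_Ioo, not_and_or, not_lt, not_lt] at hy
  rcases hy with hy | hy
  · exact Real.sin_nonpos_of_nonpos_of_neg_pi_le (by nlinarith) (by nlinarith)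
  · rw [← Real.sin_sub_two_pi]
    exact Real.sin_nonpos_of_nonpos_of_neg_pi_le (by nlinarith) (by nlinarith)

/-- Each step multiplies the expectation of the eigenfunction by its eigenvalue. Discarding the
paths that leave only removes nonpositive contributions, except after jumps of size at least one,
whose probability is the error charged per step. -/
lemma setIntegral_sin_stayIn_ge (hS : IsGaussianWalk S h P) {a : ℝ} (ha0 : 0 < a) (ha1 : a < 1)
    (k : ℕ) :
    Real.exp (-(Real.pi ^ 2 * h / 2)) ^ k * Real.sin (Real.pi * a)
        - k * (gaussianReal 0 h).real {x | 1 ≤ |x|}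
      ≤ ∫ ω in stayIn S (Set.Ioo (-a) (1 - a)) k, Real.sin (Real.pi * S k ω + Real.pi * a) ∂P := by
  set J := Set.Ioo (-a) (1 - a)
  have hJ : MeasurableSet J := measurableSet_Ioo
  set q := (gaussianReal 0 h).real {x | 1 ≤ |x|}
  have hq : 0 ≤ q := measureReal_nonneg
  set r := Real.exp (-(Real.pi ^ 2 * h / 2))
  have hr1 : r ≤ 1 := Real.exp_le_one_iff.2 (by have := h.2; simp; positivity)
  have hr0 : 0 ≤ r := (Real.exp_pos _).le
  induction k with
  | zero =>
    have : stayIn S J 0 =ᵐ[P] Set.univ := by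
      filter_upwards [hS.zero] with ω hω
      refine eq_true ?_ |>.trans (eq_true trivial).symm
      intro i hi
      obtain rfl : i = 0 := by omega
      rw [hω]; constructor <;> linarith
    rw [setIntegral_congr_set this, setIntegral_univ]
    have h2 : ∫ ω, Real.sin (Real.pi * S 0 ω + Real.pi * a) ∂P = ∫ ω, Real.sin (Real.pi * a) ∂P := by
      refine integral_congr_ae ?_
      filter_upwards [hS.zero] with ω hω
      simp [hω]
    rw [h2]; simp
  | succ k ih =>
    have hSk := hS.measurable k
    have hSk' := hS.measurable (k + 1)
    have hA := hS.measurableSet_stayIn hJ k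
    have hm : MeasurableSet {ω | S (k + 1) ω ∈ J} := hSk' hJ
    have hm2 : MeasurableSet {ω | 1 ≤ |S (k + 1) ω - S k ω|} :=
      measurableSet_le (by fun_prop) (by fun_prop)
    have i1 : Integrable (fun ω => Real.sin (Real.pi * S (k + 1) ω + Real.pi * a)) P :=
      Integrable.of_bound (by fun_prop) 1 (ae_of_all _ fun _ => Real.abs_sin_le_one _)
    have i2 : Integrable ({ω | 1 ≤ |S (k + 1) ω - S k ω|}.indicator (1 : Ω → ℝ)) P :=
      (integrable_const _).indicator hm2
    have step : ∫ ω in stayIn S J k, Real.sin (Real.pi * S (k + 1) ω + Real.pi * a) ∂P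
        ≤ ∫ ω in stayIn S J k, ({ω | S (k + 1) ω ∈ J}.indicator
            (fun ω => Real.sin (Real.pi * S (k + 1) ω + Real.pi * a)) ω
          + {ω | 1 ≤ |S (k + 1) ω - S k ω|}.indicator (1 : Ω → ℝ) ω) ∂P := by
      refine setIntegral_mono_on i1.integrableOn ((i1.indicator hm).add i2).integrableOn hA
        fun ω hω => ?_
      exact sin_le_indicator_add_indicator (a := a) (x := S k ω) (y := S (k + 1) ω) (hω k le_rfl)
    rw [hS.setIntegral_sin_succ hJ, integral_add (i1.indicator hm).integrableOn i2.integrableOn,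
      setIntegral_indicator hm, ← stayIn_succ] at step
    have hlast : ∫ ω in stayIn S J k, {ω | 1 ≤ |S (k + 1) ω - S k ω|}.indicator (1 : Ω → ℝ) ω ∂P
        ≤ q := by
      rw [setIntegral_indicator hm2]
      simp only [Pi.one_apply, setIntegral_const, smul_eq_mul, mul_one]
      exact (measureReal_mono Set.inter_subset_right).trans (hS.measureReal_step k 1).le
    have hmul := mul_le_mul_of_nonneg_left ih hr0
    have : r * (k * q) ≤ k * q := mul_le_of_le_one_left (by positivity) hr1
    push_cast
    rw [pow_succ]
    linarith

/-- Lower bound for the probability that a Gaussian walk stays in an interval of unit length. -/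
lemma le_measureReal_stayIn (hS : IsGaussianWalk S h P) {a : ℝ} (ha0 : 0 < a) (ha1 : a < 1)
    (n : ℕ) :
    Real.exp (-(Real.pi ^ 2 * (n * h) / 2)) * Real.sin (Real.pi * a)
        - n * (gaussianReal 0 h).real {x | 1 ≤ |x|}
      ≤ P.real (stayIn S (Set.Ioo (-a) (1 - a)) n) := by
  have h1 := hS.setIntegral_sin_stayIn_ge ha0 ha1 n
  rw [← Real.exp_nat_mul] at h1
  have hSn := hS.measurable n
  have h2 : ∫ ω in stayIn S (Set.Ioo (-a) (1 - a)) n, Real.sin (Real.pi * S n ω + Real.pi * a) ∂P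
      ≤ ∫ ω in stayIn S (Set.Ioo (-a) (1 - a)) n, (1 : ℝ) ∂P :=
    setIntegral_mono (Integrable.of_bound (by fun_prop) 1
      (ae_of_all _ fun _ => Real.abs_sin_le_one _)) (integrable_const _)
      fun ω => Real.sin_le_one _
  simp only [setIntegral_const, smul_eq_mul, mul_one] at h2
  refine le_trans (le_of_eq ?_) (h1.trans h2)
  congr 3; ring

lemma half_le_sin {x : ℝ} (h1 : Real.pi / 6 ≤ x) (h2 : x ≤ 5 * Real.pi / 6) :
    1 / 2 ≤ Real.sin x := by
  have hpi := Real.pi_pos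
  rw [← Real.sin_pi_div_six]
  rcases le_total x (Real.pi / 2) with h | h
  · exact Real.sin_le_sin_of_le_of_le_pi_div_two (by linarith) h h1
  · rw [← Real.sin_pi_sub x]
    exact Real.sin_le_sin_of_le_of_le_pi_div_two (by linarith) (by linarith) (by linarith)

lemma three_quarters_le_sin {x : ℝ} (h1 : Real.pi / 3 ≤ x) (h2 : x ≤ 2 * Real.pi / 3) :
    3 / 4 ≤ Real.sin x := by
  have hpi := Real.pi_pos
  have h3 : (3 / 4 : ℝ) ≤ Real.sin (Real.pi / 3) := by
    rw [Real.sin_pi_div_three]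
    have : (3 / 2 : ℝ) ≤ √3 := Real.le_sqrt_of_sq_le (by norm_num)
    linarith
  refine h3.trans ?_
  rcases le_total x (Real.pi / 2) with h | h
  · exact Real.sin_le_sin_of_le_of_le_pi_div_two (by linarith) h h1
  · rw [← Real.sin_pi_sub x]
    exact Real.sin_le_sin_of_le_of_le_pi_div_two (by linarith) (by linarith) (by linarith)

/-- A bounded function which is superharmonic near `[-a, 1 - 2a]`, small at `0` and nonnegative
on a neighbourhood of that interval. -/
noncomputable def barrier (a x : ℝ) : ℝ :=
  Real.sin (Real.pi / 6 * x + (Real.pi / 6 * (2 * a) + Real.pi / 6)) - 1 / 2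

lemma barrier_nonneg {a x : ℝ} (h1 : 0 ≤ x + 2 * a) (h2 : x + 2 * a ≤ 4) : 0 ≤ barrier a x := by
  have hpi := Real.pi_pos
  have := half_le_sin (x := Real.pi / 6 * x + (Real.pi / 6 * (2 * a) + Real.pi / 6))
    (by nlinarith) (by nlinarith)
  rw [barrier]; linarith

lemma abs_barrier_le (a x : ℝ) : |barrier a x| ≤ 3 / 2 := by
  rw [barrier, abs_le]
  have h1 := Real.sin_le_one (Real.pi / 6 * x + (Real.pi / 6 * (2 * a) + Real.pi / 6))
  have h2 := Real.neg_one_le_sin (Real.pi / 6 * x + (Real.pi / 6 * (2 * a) + Real.pi / 6))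
  constructor <;> linarith

lemma measurable_barrier (a : ℝ) : Measurable (barrier a) := by
  unfold barrier; fun_prop

lemma barrier_zero_le {a : ℝ} (ha : 0 ≤ a) : barrier a 0 ≤ 2 * a := by
  have hpi := Real.pi_pos
  have hpi4 := Real.pi_le_four
  have h1 : Real.sin (Real.pi / 6 * (2 * a)) ≤ Real.pi / 6 * (2 * a) := Real.sin_le (by positivity)
  have h2 : 0 ≤ Real.pi / 6 * (2 * a) := by positivity
  rw [barrier, mul_zero, zero_add, Real.sin_add, Real.sin_pi_div_six]
  have h3 := Real.cos_le_one (Real.pi / 6 * (2 * a))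
  have h4 := Real.cos_le_one (Real.pi / 6)
  have h5 : 0 ≤ Real.cos (Real.pi / 6) := by rw [Real.cos_pi_div_six]; positivity
  have h6 : Real.sin (Real.pi / 6 * (2 * a)) * Real.cos (Real.pi / 6) ≤ Real.pi / 6 * (2 * a) := by
    nlinarith
  nlinarith

/-- A jump shorter than `a` that exits below stays above `-2a`, where the barrier is still
nonnegative; one that exits above lands where the barrier is at least 1/4. For longer jumps the term
2 outweighs the possible negative value of the barrier. -/
lemma barrier_step {a x y : ℝ} (ha1 : a ≤ 1) (hx : x ∈ Set.Icc (-a) (1 - 2 * a)) :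
    (Set.Icc (-a) (1 - 2 * a)).indicator (barrier a) y
      + (Set.Ioi (1 - 2 * a)).indicator (fun _ => 1 / 4) y
      ≤ barrier a y + {z : ℝ | a ≤ |z|}.indicator (fun _ => 2) (y - x) := by
  have hpi := Real.pi_pos
  obtain ⟨hx1, hx2⟩ := hx
  have hb := abs_le.1 (abs_barrier_le a y)
  by_cases hz : a ≤ |y - x|
  · rw [Set.indicator_of_mem (s := {z : ℝ | a ≤ |z|}) hz]
    by_cases h1 : y ∈ Set.Ioi (1 - 2 * a)
    · rw [Set.indicator_of_mem h1, Set.indicator_of_notMem (fun h => not_lt.2 h.2 h1)]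
      linarith
    · rw [Set.indicator_of_notMem h1]
      by_cases h2 : y ∈ Set.Icc (-a) (1 - 2 * a)
      · rw [Set.indicator_of_mem h2]; linarith
      · rw [Set.indicator_of_notMem h2]; linarith
  · rw [Set.indicator_of_notMem (s := {z : ℝ | a ≤ |z|}) hz]
    rw [not_le, abs_lt] at hz
    by_cases h1 : y ∈ Set.Ioi (1 - 2 * a)
    · rw [Set.indicator_of_mem h1, Set.indicator_of_notMem (fun h => not_lt.2 h.2 h1)]
      rw [Set.mem_Ioi] at h1
      have := three_quarters_le_sin (x := Real.pi / 6 * y + (Real.pi / 6 * (2 * a) + Real.pi / 6))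
        (by nlinarith) (by nlinarith)
      rw [barrier]; linarith
    · rw [Set.indicator_of_notMem h1]
      rw [Set.mem_Ioi, not_lt] at h1
      have h0 : 0 ≤ barrier a y := barrier_nonneg (by linarith) (by linarith)
      by_cases h2 : y ∈ Set.Icc (-a) (1 - 2 * a)
      · rw [Set.indicator_of_mem h2]
      · rw [Set.indicator_of_notMem h2]; linarith

/-- A supermartingale balance. The barrier starts at no more than `2a`; every step spent in the
interval lowers its expectation by a fixed multiple of the staying probability, because the sine
there is at least 1/2; and every exit through the top collects at least 1/4. Large jumps account for
the error. -/
lemma barrier_sum_le (hS : IsGaussianWalk S h P) {a : ℝ} (ha : 0 < a) (ha1 : a ≤ 1) (n : ℕ) :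
    ∫ ω in stayIn S (Set.Icc (-a) (1 - 2 * a)) n, barrier a (S n ω) ∂P
      + (1 - Real.exp (-((Real.pi / 6) ^ 2 * h / 2))) / 2 *
        (n * P.real (stayIn S (Set.Icc (-a) (1 - 2 * a)) n))
      + 1 / 4 * P.real (stayIn S (Set.Ici (-a)) n \ stayIn S (Set.Icc (-a) (1 - 2 * a)) n)
      ≤ 2 * a + n * (2 * (gaussianReal 0 h).real {x | a ≤ |x|}) := by
  set J := Set.Icc (-a) (1 - 2 * a)
  have hJ : MeasurableSet J := measurableSet_Icc
  set q := (gaussianReal 0 h).real {x | a ≤ |x|}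
  have hq : 0 ≤ q := measureReal_nonneg
  set r := Real.exp (-((Real.pi / 6) ^ 2 * h / 2))
  have hr1 : r ≤ 1 := Real.exp_le_one_iff.2 (by have := h.2; rw [neg_nonpos]; positivity)
  have hint : ∀ k, Integrable (fun ω => barrier a (S k ω)) P := fun k =>
    Integrable.of_bound ((measurable_barrier a).comp (hS.measurable k)).aestronglyMeasurable (3 / 2)
      (ae_of_all _ fun _ => abs_barrier_le _ _)
  induction n with
  | zero =>
    have h0 : stayIn S (Set.Ici (-a)) 0 \ stayIn S J 0 ⊆ {ω | S 0 ω ∉ J} := by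
      rintro ω ⟨-, h2⟩ h3
      refine h2 fun i hi => ?_
      obtain rfl : i = 0 := by omega
      exact h3
    -- For `a > 1/2` the starting point lies outside the interval, but then `2a` already exceeds the
    -- left-hand side.
    by_cases hJ0 : (0 : ℝ) ∈ J
    · have e1 : P.real (stayIn S (Set.Ici (-a)) 0 \ stayIn S J 0) = 0 := by
        rw [measureReal_eq_zero_iff]
        refine measure_mono_null h0 ?_
        have : ∀ᵐ ω ∂P, S 0 ω ∈ J := by filter_upwards [hS.zero] with ω hω; rwa [hω]
        exact this
      have e2 : ∫ ω in stayIn S J 0, barrier a (S 0 ω) ∂P ≤ ∫ ω in stayIn S J 0, 2 * a ∂P := by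
        refine integral_mono_ae (hint 0).integrableOn (integrable_const _) ?_
        filter_upwards [ae_restrict_of_ae hS.zero] with ω hω
        rw [hω]; exact barrier_zero_le ha.le
      have e3 : P.real (stayIn S J 0) ≤ 1 := measureReal_le_one
      simp only [setIntegral_const, smul_eq_mul] at e2
      rw [e1]; push_cast; nlinarith
    · have e0 : P.real (stayIn S J 0) = 0 := by
        rw [measureReal_eq_zero_iff]
        have : ∀ᵐ ω ∂P, ω ∉ stayIn S J 0 := by
          filter_upwards [hS.zero] with ω hω h
          have := h 0 le_rfl
          rw [hω] at this; exact hJ0 this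
        simpa [ae_iff] using this
      have ha2 : 1 / 2 < a := by
        by_contra hcon
        exact hJ0 ⟨by linarith, by linarith⟩
      have e2 : ∫ ω in stayIn S J 0, barrier a (S 0 ω) ∂P = 0 := by
        refine setIntegral_measure_zero _ ?_
        rwa [measureReal_eq_zero_iff] at e0
      have e3 : P.real (stayIn S (Set.Ici (-a)) 0 \ stayIn S J 0) ≤ 1 := measureReal_le_one
      rw [e0, e2]; push_cast; linarith
  | succ k ih =>
    have hSk := hS.measurable k
    have hSk' := hS.measurable (k + 1)
    have hA := hS.measurableSet_stayIn hJ k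
    have hm : MeasurableSet {ω | S (k + 1) ω ∈ J} := hSk' hJ
    have hmB : MeasurableSet {ω | S (k + 1) ω ∈ Set.Ioi (1 - 2 * a)} := hSk' measurableSet_Ioi
    have hm2 : MeasurableSet {ω | a ≤ |S (k + 1) ω - S k ω|} :=
      measurableSet_le (by fun_prop) (by fun_prop)
    have i2 : Integrable ({ω | a ≤ |S (k + 1) ω - S k ω|}.indicator (fun _ => (2 : ℝ))) P :=
      (integrable_const _).indicator hm2
    have i3 : Integrable ({ω | S (k + 1) ω ∈ Set.Ioi (1 - 2 * a)}.indicator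
        (fun _ => (1 / 4 : ℝ))) P := (integrable_const _).indicator hmB
    have step : ∫ ω in stayIn S J k, ({ω | S (k + 1) ω ∈ J}.indicator
            (fun ω => barrier a (S (k + 1) ω)) ω
          + {ω | S (k + 1) ω ∈ Set.Ioi (1 - 2 * a)}.indicator (fun _ => (1 / 4 : ℝ)) ω) ∂P
        ≤ ∫ ω in stayIn S J k, (barrier a (S (k + 1) ω)
          + {ω | a ≤ |S (k + 1) ω - S k ω|}.indicator (fun _ => (2 : ℝ)) ω) ∂P := by
      refine setIntegral_mono_on (((hint _).indicator hm).add i3).integrableOn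
        ((hint _).add i2).integrableOn hA fun ω hω => ?_
      exact barrier_step ha1 (hω k le_rfl)
    rw [integral_add ((hint _).indicator hm).integrableOn i3.integrableOn,
      integral_add (hint _).integrableOn i2.integrableOn,
      setIntegral_indicator hm, ← stayIn_succ, setIntegral_indicator hmB,
      setIntegral_indicator hm2, setIntegral_const, setIntegral_const, smul_eq_mul,
      smul_eq_mul] at step
    have hlast : P.real (stayIn S J k ∩ {ω | a ≤ |S (k + 1) ω - S k ω|}) ≤ q :=
      (measureReal_mono Set.inter_subset_right).trans (hS.measureReal_step k a).le
    have isin : ∀ j, Integrable (fun ω => Real.sin (Real.pi / 6 * S j ω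
        + (Real.pi / 6 * (2 * a) + Real.pi / 6))) P := fun j => by
      have := hS.measurable j
      exact Integrable.of_bound (by fun_prop) 1 (ae_of_all _ fun _ => Real.abs_sin_le_one _)
    have hdec : ∀ j, ∫ ω in stayIn S J k, barrier a (S j ω) ∂P
        = ∫ ω in stayIn S J k, Real.sin (Real.pi / 6 * S j ω
          + (Real.pi / 6 * (2 * a) + Real.pi / 6)) ∂P - P.real (stayIn S J k) * (1 / 2) := by
      intro j
      unfold barrier
      rw [integral_sub (isin j).integrableOn (integrable_const _), setIntegral_const, smul_eq_mul]
    rw [hdec (k + 1), hS.setIntegral_sin_succ hJ] at step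
    rw [hdec k] at ih
    have hlow : P.real (stayIn S J k) * (1 / 2) ≤ ∫ ω in stayIn S J k, Real.sin (Real.pi / 6 * S k ω
          + (Real.pi / 6 * (2 * a) + Real.pi / 6)) ∂P := by
      rw [← smul_eq_mul, ← setIntegral_const]
      refine setIntegral_mono_on (integrable_const _) (isin k).integrableOn hA fun ω hω => ?_
      obtain ⟨h1, h2⟩ := hω k le_rfl
      have := barrier_nonneg (a := a) (x := S k ω) (by linarith) (by linarith)
      rw [barrier] at this; linarith
    have hexit : P.real (stayIn S (Set.Ici (-a)) (k + 1) \ stayIn S J (k + 1))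
        ≤ P.real (stayIn S (Set.Ici (-a)) k \ stayIn S J k)
          + P.real (stayIn S J k ∩ {ω | S (k + 1) ω ∈ Set.Ioi (1 - 2 * a)}) := by
      refine (measureReal_mono ?_).trans (measureReal_union_le _ _)
      rw [stayIn_succ, stayIn_succ]
      rintro ω ⟨⟨h1, h2⟩, h3⟩
      by_cases h4 : ω ∈ stayIn S J k
      · refine Or.inr ⟨h4, ?_⟩
        by_contra h5
        exact h3 ⟨h4, h2, not_lt.1 h5⟩
      · exact Or.inl ⟨h1, h4⟩
    have hmono : P.real (stayIn S J (k + 1)) ≤ P.real (stayIn S J k) := by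
      rw [stayIn_succ]; exact measureReal_mono Set.inter_subset_left
    have hmul := mul_le_mul_of_nonneg_left hlow (sub_nonneg.2 hr1)
    have hmul2 : (1 - r) / 2 * ((k + 1 : ℝ) * P.real (stayIn S J (k + 1)))
        ≤ (1 - r) / 2 * ((k + 1 : ℝ) * P.real (stayIn S J k)) := by
      have : 0 ≤ 1 - r := sub_nonneg.2 hr1
      gcongr
    push_cast
    linarith

/-- Upper bound for the probability that a Gaussian walk of unit total variance stays above
`-a`. -/
lemma measureReal_stayIn_Ici_le {n : ℕ} (hn : n ≠ 0) (hS : IsGaussianWalk S (n : ℝ≥0)⁻¹ P) {a : ℝ}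
    (ha : 0 < a) (ha1 : a ≤ 1) :
    P.real (stayIn S (Set.Ici (-a)) n)
      ≤ 64 * (a + n * (gaussianReal 0 (n : ℝ≥0)⁻¹).real {x | a ≤ |x|}) := by
  have key := hS.barrier_sum_le ha ha1 n
  set J := Set.Icc (-a) (1 - 2 * a)
  have h0 : 0 ≤ ∫ ω in stayIn S J n, barrier a (S n ω) ∂P := by
    refine setIntegral_nonneg (hS.measurableSet_stayIn measurableSet_Icc n) fun ω hω => ?_
    obtain ⟨h1, h2⟩ := hω n le_rfl
    exact barrier_nonneg (by linarith) (by linarith)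
  have hsplit : P.real (stayIn S (Set.Ici (-a)) n) ≤ P.real (stayIn S J n)
      + P.real (stayIn S (Set.Ici (-a)) n \ stayIn S J n) := by
    refine (measureReal_mono ?_).trans (measureReal_union_le _ _)
    intro ω hω
    by_cases h : ω ∈ stayIn S J n
    · exact Or.inl h
    · exact Or.inr ⟨hω, h⟩
  have hn1 : (1 : ℝ) ≤ n := by exact_mod_cast Nat.one_le_iff_ne_zero.2 hn
  have hpi3 := Real.pi_gt_three
  have hpi4 := Real.pi_le_four
  set u := (Real.pi / 6) ^ 2 * ((n : ℝ≥0)⁻¹ : ℝ≥0) / 2 with hu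
  have hun : u * n = (Real.pi / 6) ^ 2 / 2 := by
    rw [hu]; push_cast; field_simp
  have hu0 : 0 ≤ u := by positivity
  have hu1 : u ≤ 1 := by nlinarith
  have hexp : u / 2 ≤ 1 - Real.exp (-u) := by
    have h1 := Real.add_one_le_exp u
    have h2 : Real.exp (-u) * Real.exp u = 1 := by rw [← Real.exp_add]; simp
    have h3 := Real.exp_pos (-u)
    have : Real.exp (-u) * (1 + u) ≤ 1 := by nlinarith
    nlinarith
  -- The left-over mass is at least u·n/4 = π²/288, and π > 3 makes this at least 1/32.
  have hcoef : 1 / 32 ≤ (1 - Real.exp (-u)) / 2 * n := by nlinarith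
  have hA := measureReal_nonneg (μ := P) (s := stayIn S J n)
  have hB := measureReal_nonneg (μ := P) (s := stayIn S (Set.Ici (-a)) n \ stayIn S J n)
  nlinarith

end IsGaussianWalk

/-! ### Upper bounds for Brownian confinement, without path continuity -/

/-- The event that the process `Y` stays in `[-a, b]` up to time `t`. -/
def confined {Ω : Type*} (Y : ℝ≥0 → Ω → ℝ) (t : ℝ≥0) (a b : ℝ) : Set Ω :=
  {ω | ∀ s ≤ t, -a ≤ Y s ω ∧ Y s ω ≤ b}

/-- The event that `Y` stays above `-a` at all rational multiples of `T` in `[0, T]`. -/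
def aboveAtRational {Ω : Type*} (Y : ℝ≥0 → Ω → ℝ) (T : ℝ≥0) (a : ℝ) : Set Ω :=
  {ω | ∀ n k : ℕ, k ≤ n → -a ≤ Y (T * (k * (n : ℝ≥0)⁻¹)) ω}

namespace ProbabilityTheory.IsPreBrownianReal

variable {Ω : Type*} [MeasurableSpace Ω] {P : Measure Ω} [IsProbabilityMeasure P]
  {Y : ℝ≥0 → Ω → ℝ}

omit [IsProbabilityMeasure P] in
-- The values of `Y` are only almost everywhere measurable, so the walk is built from measurable
-- modifications at the grid times.
lemma exists_isGaussianWalk (hY : IsPreBrownianReal Y P) (h : ℝ≥0) :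
    ∃ S : ℕ → Ω → ℝ, IsGaussianWalk S h P ∧ ∀ᵐ ω ∂P, ∀ k : ℕ, S k ω = Y (k * h) ω := by
  refine ⟨fun k => (hY.aemeasurable (k * h)).mk _, ?_, ?_⟩
  swap
  · rw [ae_all_iff]
    intro k
    exact ((hY.aemeasurable (k * h)).ae_eq_mk).symm
  have hmk : ∀ k : ℕ, Y (k * h) =ᵐ[P] (hY.aemeasurable (k * h)).mk _ := fun k =>
    (hY.aemeasurable (k * h)).ae_eq_mk
  refine ⟨fun k => (hY.aemeasurable (k * h)).measurable_mk, ?_, fun k => ?_, fun k => ?_⟩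
  · filter_upwards [hmk 0, hY.eval_zero_ae_eq_zero] with ω h1 h2
    rw [← h1]
    simpa using h2
  · have h1 := hY.hasLaw_sub ((k + 1 : ℕ) * h) (k * h)
    have h2 : nndist (((k + 1 : ℕ) * h : ℝ≥0) : ℝ) ((k * h : ℝ≥0) : ℝ) = h := by
      ext
      rw [coe_nndist, Real.dist_eq]
      push_cast
      rw [add_mul, one_mul, add_sub_cancel_left, abs_of_nonneg h.coe_nonneg]
    simp only [NNReal.val_eq_coe] at h1
    rw [h2] at h1
    refine h1.congr ?_
    filter_upwards [hmk k, hmk (k + 1)] with ω e1 e2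
    rw [Pi.sub_apply, e1, e2]
  · have h1 := hY.indepFun_shift (k * h)
    have h2 := h1.comp (φ := fun w : ℝ≥0 → ℝ => w h)
      (ψ := fun (w : Set.Iic ((k : ℝ≥0) * h) → ℝ) (i : Set.Iic k) =>
        w ⟨(i : ℕ) * h, Set.mem_Iic.2 (by have : (i : ℕ) ≤ k := i.2; gcongr)⟩)
      (measurable_pi_apply h : Measurable fun w : ℝ≥0 → ℝ => w h) (by fun_prop)
    refine h2.congr ?_ ?_
    · filter_upwards [hmk k, hmk (k + 1)] with ω e1 e2
      simp only [Function.comp_apply]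
      rw [← e1, ← e2]
      congr 2
      push_cast; ring
    · have : ∀ᵐ ω ∂P, ∀ k : ℕ, Y (k * h) ω = (hY.aemeasurable (k * h)).mk _ ω :=
        ae_all_iff.2 hmk
      filter_upwards [this] with ω hω
      funext i
      exact hω i

lemma tendsto_mul_gaussianReal_tail {a : ℝ} (ha : 0 < a) :
    Tendsto (fun n : ℕ => (n : ℝ) * (gaussianReal 0 (n : ℝ≥0)⁻¹).real {x | a ≤ |x|}) atTop
      (nhds 0) := by
  have h1 : Tendsto (fun n : ℕ => 2 * ((n : ℝ) ^ 1 * Real.exp (-(a ^ 2 / 2)) ^ n)) atTop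
      (nhds (2 * 0)) := by
    refine Tendsto.const_mul _ (tendsto_pow_const_mul_const_pow_of_abs_lt_one 1 ?_)
    rw [abs_of_pos (Real.exp_pos _), Real.exp_lt_one_iff]
    have : 0 < a ^ 2 := by positivity
    linarith
  rw [mul_zero] at h1
  refine squeeze_zero (fun n => by positivity) (fun n => ?_) h1
  have h2 := gaussianReal_measureReal_ge_le (n : ℝ≥0)⁻¹ ha.le
  calc _ ≤ (n : ℝ) * (2 * Real.exp (-a ^ 2 / (2 * ((n : ℝ≥0)⁻¹ : ℝ≥0)))) := by gcongr
    _ = _ := by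
      rw [← Real.exp_nat_mul]
      push_cast
      have : -a ^ 2 / (2 * (n : ℝ)⁻¹) = n * (-(a ^ 2 / 2)) := by
        rcases eq_or_ne n 0 with rfl | hn
        · simp
        · field_simp
      rw [this]; ring

/-- The event implies that the walk on every grid of mesh 1/n stays above `-a`. The walk bound
therefore applies for each n, and its large-jump error tends to zero. -/
lemma measureReal_aboveAtRational_one_le (hY : IsPreBrownianReal Y P) {a : ℝ} (ha : 0 < a)
    (ha1 : a ≤ 1) : P.real (aboveAtRational Y 1 a) ≤ 64 * a := by
  have hlim : Tendsto (fun n : ℕ => 64 * (a + (n : ℝ) *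
      (gaussianReal 0 (n : ℝ≥0)⁻¹).real {x | a ≤ |x|})) atTop (nhds (64 * (a + 0))) :=
    ((tendsto_mul_gaussianReal_tail ha).const_add a).const_mul 64
  rw [add_zero] at hlim
  refine ge_of_tendsto hlim ?_
  filter_upwards [eventually_ne_atTop 0] with n hn
  obtain ⟨S, hS, hSY⟩ := hY.exists_isGaussianWalk (n : ℝ≥0)⁻¹
  refine le_trans ?_ (hS.measureReal_stayIn_Ici_le hn ha ha1)
  refine ENNReal.toReal_mono (measure_ne_top _ _) (measure_mono_ae ?_)
  filter_upwards [hSY] with ω hω h i hi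
  rw [Set.mem_Ici, hω]
  simpa using h n i hi

lemma measureReal_aboveAtRational_le (hY : IsPreBrownianReal Y P) {T : ℝ≥0} (hT : T ≠ 0) {a : ℝ}
    (ha : 0 < a) : P.real (aboveAtRational Y T a) ≤ 64 * (a / √T) := by
  have hsT : 0 < √(T : ℝ) := Real.sqrt_pos.2 (by exact_mod_cast pos_of_ne_zero hT)
  rcases le_or_gt (a / √T) 1 with h | h
  · refine le_trans (le_of_eq ?_) ((hY.smul hT).measureReal_aboveAtRational_one_le
      (a := a / √T) (by positivity) h)
    congr 1
    ext ω
    refine forall_congr' fun n => forall_congr' fun k => imp_congr_right fun _ => ?_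
    rw [one_mul, ← neg_div, div_le_iff₀ hsT]
    change _ ↔ _ ≤ (√(T : ℝ))⁻¹ * Y (T * (k * (n : ℝ≥0)⁻¹)) ω * √T
    rw [mul_comm (√(T : ℝ))⁻¹, inv_mul_cancel_right₀ hsT.ne']
  · exact measureReal_le_one.trans (by linarith)

/-- Adding the requirement that the next increment is small costs an independent factor. -/
lemma measureReal_inter_increment_le (hY : IsPreBrownianReal Y P) {t T : ℝ≥0} (hT : T ≠ 0) {b : ℝ}
    (hbT : b ^ 2 ≤ T) {E : Set (Set.Iic t → ℝ)} (hE : MeasurableSet E) :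
    P.real ({ω | (fun s : Set.Iic t => Y s ω) ∈ E} ∩ {ω | |Y (t + T) ω - Y t ω| ≤ 2 * b})
      ≤ P.real {ω | (fun s : Set.Iic t => Y s ω) ∈ E}
        * (gaussianReal 0 1).real {x | |x| ≤ 2} := by
  have hm : MeasurableSet {w : ℝ≥0 → ℝ | |w T| ≤ 2 * b} :=
    measurableSet_le (by fun_prop) (by fun_prop)
  have hind := (hY.indepFun_shift t).symm.measure_inter_preimage_eq_mul _ _ hE hm
  have hreal := congrArg ENNReal.toReal hind
  rw [ENNReal.toReal_mul] at hreal
  change P.real ({ω | (fun s : Set.Iic t => Y s ω) ∈ E} ∩ {ω | |Y (t + T) ω - Y t ω| ≤ 2 * b})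
    = P.real {ω | (fun s : Set.Iic t => Y s ω) ∈ E} * P.real {ω | |Y (t + T) ω - Y t ω| ≤ 2 * b}
    at hreal
  rw [hreal]
  refine mul_le_mul_of_nonneg_left ?_ measureReal_nonneg
  have hlaw := ((hY.shift t).smul hT).hasLaw_eval 1
  rw [← hlaw.measureReal_eq (p := fun x => |x| ≤ 2) (measurableSet_le (by fun_prop) (by fun_prop))]
  refine measureReal_mono fun ω hω => ?_
  have hsT : 0 < √(T : ℝ) := Real.sqrt_pos.2 (by exact_mod_cast pos_of_ne_zero hT)
  have hbs : b ≤ √(T : ℝ) := Real.le_sqrt_of_sq_le hbT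
  have hω' : |Y (t + T) ω - Y t ω| ≤ 2 * b := hω
  change |(√(T : ℝ))⁻¹ * (Y (t + T * 1) ω - Y t ω)| ≤ 2
  rw [mul_one, abs_mul, abs_of_pos (inv_pos.2 hsT), inv_mul_le_iff₀ hsT]
  linarith

/-- By induction, each block after the first contributes an independent factor; only the first block
is used for the cost of staying above `-a`. -/
lemma measureReal_above_increments_le (hY : IsPreBrownianReal Y P) {T : ℝ≥0} (hT : T ≠ 0) {a b : ℝ}
    (ha : 0 < a) (hbT : b ^ 2 ≤ T) (N : ℕ) :
    P.real (aboveAtRational Y T a ∩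
        {ω | ∀ j < N, |Y ((j + 1 : ℕ) * T + T) ω - Y ((j + 1 : ℕ) * T) ω| ≤ 2 * b})
      ≤ 64 * (a / √T) * (gaussianReal 0 1).real {x | |x| ≤ 2} ^ N := by
  induction N with
  | zero => simpa using hY.measureReal_aboveAtRational_le hT ha
  | succ N ih =>
    set t : ℝ≥0 := (N + 1 : ℕ) * T with ht
    -- Truncation at `t` turns the relevant times, all at most `t`, into indices of the past path,
    -- so that the past event is a measurable set of such paths.
    let c : ℝ≥0 → Set.Iic t := fun s => ⟨min s t, Set.mem_Iic.2 (min_le_right _ _)⟩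
    let E : Set (Set.Iic t → ℝ) :=
      {w | (∀ n k : ℕ, k ≤ n → -a ≤ w (c (T * (k * (n : ℝ≥0)⁻¹)))) ∧
        ∀ j < N, |w (c ((j + 1 : ℕ) * T + T)) - w (c ((j + 1 : ℕ) * T))| ≤ 2 * b}
    have hE : MeasurableSet E := by
      refine MeasurableSet.inter ?_ ?_
      · change MeasurableSet {w : Set.Iic t → ℝ |
          ∀ n k : ℕ, k ≤ n → -a ≤ w (c (T * (k * (n : ℝ≥0)⁻¹)))}
        simp only [Set.ofPred_forall]
        exact MeasurableSet.iInter fun n => MeasurableSet.iInter fun k =>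
          MeasurableSet.iInter fun _ => measurableSet_le (by fun_prop) (by fun_prop)
      · change MeasurableSet {w : Set.Iic t → ℝ |
          ∀ j < N, |w (c ((j + 1 : ℕ) * T + T)) - w (c ((j + 1 : ℕ) * T))| ≤ 2 * b}
        simp only [Set.ofPred_forall]
        exact MeasurableSet.iInter fun j => MeasurableSet.iInter fun _ =>
          measurableSet_le (by fun_prop) (by fun_prop)
    have hTt : T ≤ t := by
      rw [ht]; push_cast; rw [add_mul, one_mul]; exact le_add_self
    have hpast : aboveAtRational Y T a ∩
        {ω | ∀ j < N, |Y ((j + 1 : ℕ) * T + T) ω - Y ((j + 1 : ℕ) * T) ω| ≤ 2 * b}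
        = {ω | (fun s : Set.Iic t => Y s ω) ∈ E} := by
      ext ω
      refine and_congr ?_ ?_
      · refine forall_congr' fun n => forall_congr' fun k => imp_congr_right fun hk => ?_
        have : T * (k * (n : ℝ≥0)⁻¹) ≤ t := by
          refine le_trans ?_ hTt
          refine mul_le_of_le_one_right' ?_
          rw [← div_eq_mul_inv]
          exact div_le_one_of_le₀ (by exact_mod_cast hk) (by positivity)
        simp only [c, min_eq_left this]
      · refine forall_congr' fun j => imp_congr_right fun hj => ?_
        have h1 : ((j + 1 : ℕ) : ℝ≥0) * T + T ≤ t := by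
          rw [ht, ← add_one_mul]
          gcongr
          exact_mod_cast (by omega : j + 1 + 1 ≤ N + 1)
        have h2 : ((j + 1 : ℕ) : ℝ≥0) * T ≤ t := le_trans le_self_add h1
        simp only [c, min_eq_left h1, min_eq_left h2]
    rw [pow_succ, ← mul_assoc]
    refine le_trans ?_ (mul_le_mul_of_nonneg_right ih measureReal_nonneg)
    rw [hpast]
    refine le_trans ?_ (hY.measureReal_inter_increment_le hT hbT hE)
    rw [← hpast]
    refine measureReal_mono ?_
    rintro ω ⟨h1, h2⟩
    exact ⟨⟨h1, fun j hj => h2 j (by omega)⟩, h2 N (by omega)⟩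

/-- Cut [0, 1] into N + 1 equal blocks. Confinement to [-a, b] with `a ≤ b` forces every block
increment to be at most `2b` in absolute value, while its standard deviation is at least `b`. -/
lemma measureReal_confined_le_pow (hY : IsPreBrownianReal Y P) {a b : ℝ} (ha : 0 < a) (hab : a ≤ b)
    (N : ℕ) (hb : b ^ 2 * (N + 1) ≤ 1) :
    P.real (confined Y 1 a b)
      ≤ 64 * (a * √(N + 1)) * (gaussianReal 0 1).real {x | |x| ≤ 2} ^ N := by
  set T : ℝ≥0 := (N + 1 : ℝ≥0)⁻¹ with hTdef
  have hT : T ≠ 0 := by positivity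
  have hTc : (T : ℝ) = (N + 1 : ℝ)⁻¹ := by rw [hTdef]; push_cast; rfl
  have hbT : b ^ 2 ≤ T := by
    rw [hTc, ← one_div, le_div_iff₀ (by positivity)]; exact hb
  have key := hY.measureReal_above_increments_le hT ha hbT N
  have e : a / √(T : ℝ) = a * √(N + 1) := by
    rw [hTc, Real.sqrt_inv, div_inv_eq_mul]
  rw [e] at key
  refine le_trans (measureReal_mono ?_) key
  have hT1 : T ≤ 1 := by
    rw [hTdef]; exact inv_le_one_of_one_le₀ (by simp)
  intro ω hω
  refine ⟨fun n k hk => (hω _ ?_).1, fun j hj => ?_⟩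
  · refine mul_le_one' hT1 ?_
    rw [← div_eq_mul_inv]
    exact div_le_one_of_le₀ (by exact_mod_cast hk) (by positivity)
  · have h1 : ((j + 1 : ℕ) : ℝ≥0) * T + T ≤ 1 := by
      rw [← add_one_mul, hTdef, ← div_eq_mul_inv]
      refine div_le_one_of_le₀ ?_ (by positivity)
      exact_mod_cast (by omega : j + 1 + 1 ≤ N + 1)
    have h2 : ((j + 1 : ℕ) : ℝ≥0) * T ≤ 1 := le_trans le_self_add h1
    obtain ⟨l1, u1⟩ := hω _ h1
    obtain ⟨l2, u2⟩ := hω _ h2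
    rw [abs_le]
    constructor <;> linarith

lemma gaussianReal_measureReal_abs_le_lt_one : (gaussianReal 0 1).real {x : ℝ | |x| ≤ 2} < 1 := by
  have hm : MeasurableSet {x : ℝ | |x| ≤ 2} := measurableSet_le (by fun_prop) (by fun_prop)
  have h := probReal_compl_eq_one_sub (μ := gaussianReal 0 1) hm
  have hpos : 0 < (gaussianReal 0 1).real {x : ℝ | |x| ≤ 2}ᶜ := by
    refine measureReal_nonneg.lt_of_ne' fun h0 => ?_
    rw [measureReal_eq_zero_iff] at h0
    have h1 := gaussianReal_absolutelyContinuous' 0 one_ne_zero h0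
    have h2 : volume (Set.Ioi (2 : ℝ)) ≤ volume {x : ℝ | |x| ≤ 2}ᶜ := by
      refine measure_mono fun x hx => ?_
      simp only [Set.mem_compl_iff, Set.mem_ofPred_eq, not_le]
      exact lt_of_lt_of_le hx (le_abs_self x)
    rw [h1, Real.volume_Ioi] at h2
    simp at h2
  linarith

/-- A bound for the probability of staying in `[-a, b]` up to time `1`, with decay in `b` of
arbitrary polynomial order. -/
lemma exists_measureReal_confined_le (K : ℕ) : ∃ C : ℝ, 0 < C ∧
    ∀ {Ω : Type*} [MeasurableSpace Ω] (P : Measure Ω) [IsProbabilityMeasure P] (Y : ℝ≥0 → Ω → ℝ),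
      IsPreBrownianReal Y P → ∀ a b : ℝ, 0 < a → a ≤ b →
      P.real (confined Y 1 a b) ≤ C * (min 1 a * min 1 (b ^ (2 * K))) := by
  -- The maximum with 1/2 makes positivity of ρ immediate, as needed for dividing by ρ².
  set ρ := max ((gaussianReal 0 1).real {x : ℝ | |x| ≤ 2}) (1 / 2) with hρ
  have hρ1 : ρ < 1 := max_lt gaussianReal_measureReal_abs_le_lt_one (by norm_num)
  have hρ0 : 0 < ρ := lt_max_of_lt_right (by norm_num)
  have hlim := tendsto_pow_const_mul_const_pow_of_abs_lt_one (K + 1) (r := ρ)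
    (by rwa [abs_of_pos hρ0])
  obtain ⟨M, hM⟩ := hlim.bddAbove_range
  have hM' : ∀ n : ℕ, (n : ℝ) ^ (K + 1) * ρ ^ n ≤ M := fun n => hM ⟨n, rfl⟩
  have hM0 : 0 ≤ M := le_trans (by positivity) (hM' 0)
  refine ⟨64 * (M / ρ ^ 2 + 1), by positivity, ?_⟩
  intro Ω _ P _ Y hY a b ha hab
  have hb0 : 0 < b := ha.trans_le hab
  have hC1 : 0 ≤ M / ρ ^ 2 := by positivity
  rcases le_or_gt 1 b with hb | hb
  · rw [min_eq_left (one_le_pow₀ hb), mul_one]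
    have h1 := hY.measureReal_aboveAtRational_le one_ne_zero ha
    simp only [NNReal.coe_one, Real.sqrt_one, div_one] at h1
    have h2 : P.real (confined Y 1 a b) ≤ P.real (aboveAtRational Y 1 a) := by
      refine measureReal_mono fun ω hω n k hk => (hω _ ?_).1
      rw [one_mul, ← div_eq_mul_inv]
      exact div_le_one_of_le₀ (by exact_mod_cast hk) (by positivity)
    have h3 : P.real (confined Y 1 a b) ≤ 64 * min 1 a := by
      rcases le_total 1 a with h | h
      · rw [min_eq_left h]; exact measureReal_le_one.trans (by norm_num)
      · rw [min_eq_right h]; linarith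
    have h4 : 0 ≤ min 1 a := by positivity
    nlinarith
  · have hb2 : b ^ 2 ≤ 1 := pow_le_one₀ hb0.le hb.le
    -- The largest number of blocks whose length is still at least b². Geometric decay in this
    -- number then beats any power of 1/b².
    set m := ⌊(b ^ 2)⁻¹⌋₊ with hm
    have hm1 : 1 ≤ m := by
      rw [hm, Nat.one_le_floor_iff]
      exact (one_le_inv₀ (by positivity)).2 hb2
    obtain ⟨N, hN⟩ : ∃ N, m = N + 1 := ⟨m - 1, by omega⟩
    have hle : (N + 1 : ℝ) ≤ (b ^ 2)⁻¹ := by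
      have := Nat.floor_le (a := (b ^ 2)⁻¹) (by positivity)
      rw [← hm, hN] at this; exact_mod_cast this
    have hlt : (b ^ 2)⁻¹ < N + 2 := by
      have := Nat.lt_floor_add_one ((b ^ 2)⁻¹)
      rw [← hm, hN] at this; push_cast at this; linarith
    have hkey := hY.measureReal_confined_le_pow ha hab N (by
      have := mul_le_mul_of_nonneg_left hle (by positivity : 0 ≤ b ^ 2)
      rwa [mul_inv_cancel₀ (by positivity)] at this)
    have hρN : (gaussianReal 0 1).real {x : ℝ | |x| ≤ 2} ^ N ≤ ρ ^ N :=
      pow_le_pow_left₀ measureReal_nonneg (le_max_left _ _) N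
    have hsq : √((N : ℝ) + 1) ≤ N + 2 := by
      rw [Real.sqrt_le_left (by positivity)]
      nlinarith [(Nat.cast_nonneg N : (0 : ℝ) ≤ N)]
    have hbK : ((N : ℝ) + 2) ^ K * b ^ (2 * K) ≥ 1 := by
      rw [pow_mul, ← mul_pow]
      refine one_le_pow₀ ?_
      have := mul_le_mul_of_nonneg_right hlt.le (by positivity : 0 ≤ b ^ 2)
      rwa [inv_mul_cancel₀ (by positivity)] at this
    have hMN := hM' (N + 2)
    push_cast at hMN
    have hMN' : ((N : ℝ) + 2) ^ (K + 1) * ρ ^ N ≤ M / ρ ^ 2 := by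
      rw [le_div_iff₀ (by positivity)]
      calc _ = ((N : ℝ) + 2) ^ (K + 1) * ρ ^ (N + 2) := by ring
        _ ≤ M := hMN
    rw [min_eq_right (by linarith : a ≤ 1), min_eq_right (pow_le_one₀ hb0.le hb.le)]
    calc _ ≤ 64 * (a * √(N + 1)) * (gaussianReal 0 1).real {x | |x| ≤ 2} ^ N := hkey
      _ ≤ 64 * (a * (N + 2)) * ρ ^ N := by gcongr
      _ ≤ 64 * (a * (N + 2)) * ρ ^ N * (((N : ℝ) + 2) ^ K * b ^ (2 * K)) :=
        le_mul_of_one_le_right (by positivity) hbK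
      _ = 64 * (((N : ℝ) + 2) ^ (K + 1) * ρ ^ N) * (a * b ^ (2 * K)) := by ring
      _ ≤ 64 * (M / ρ ^ 2 + 1) * (a * b ^ (2 * K)) := by gcongr; linarith

end ProbabilityTheory.IsPreBrownianReal

/-! ### Lower bound for confinement in a unit interval -/

namespace ProbabilityTheory.IsBrownianReal

variable {Ω : Type*} [MeasurableSpace Ω] {P : Measure Ω} [IsProbabilityMeasure P]
  {Y : ℝ≥0 → Ω → ℝ}

/-- The walk bound on dyadic grids passes to the limit, since its jump error vanishes. Continuity
then extends confinement from dyadic times to all times, at the price of closing the interval.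
Jordan's inequality makes the sine linear in `a`. -/
lemma le_measureReal_confined_one (hY : IsBrownianReal Y P) {a : ℝ} (ha : 0 < a)
    (ha2 : a ≤ 1 / 2) :
    Real.exp (-(Real.pi ^ 2 / 2)) * (2 * a) ≤ P.real (confined Y 1 a (1 - a)) := by
  -- Dyadic meshes are nested, so these events decrease and their probabilities converge to that of
  -- the intersection.
  let A : ℕ → Set Ω := fun n =>
    {ω | ∀ k : ℕ, k ≤ 2 ^ n → Y (k * ((2 ^ n : ℕ) : ℝ≥0)⁻¹) ω ∈ Set.Ioo (-a) (1 - a)}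
  have hAanti : Antitone A := by
    refine antitone_nat_of_succ_le fun n ω hω k hk => ?_
    have := hω (2 * k) (by rw [pow_succ]; omega)
    convert this using 2
    push_cast
    rw [pow_succ]
    field_simp
  have hAmeas : ∀ n, NullMeasurableSet (A n) P := by
    intro n
    have : A n = ⋂ k : ℕ, ⋂ (_ : k ≤ 2 ^ n),
        {ω | Y (k * ((2 ^ n : ℕ) : ℝ≥0)⁻¹) ω ∈ Set.Ioo (-a) (1 - a)} := by
      simp only [A, Set.ofPred_forall]
    rw [this]
    exact NullMeasurableSet.iInter fun k => NullMeasurableSet.iInter fun _ =>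
      (hY.aemeasurable _).nullMeasurableSet_preimage measurableSet_Ioo
  have hlimA := tendsto_measure_iInter_atTop hAmeas hAanti ⟨0, measure_ne_top _ _⟩
  have hlimA' : Tendsto (fun n => P.real (A n)) atTop (nhds (P.real (⋂ n, A n))) :=
    (ENNReal.tendsto_toReal (measure_ne_top _ _)).comp hlimA
  have hbound : ∀ n, Real.exp (-(Real.pi ^ 2 / 2)) * Real.sin (Real.pi * a)
      - ((2 ^ n : ℕ) : ℝ) * (gaussianReal 0 ((2 ^ n : ℕ) : ℝ≥0)⁻¹).real {x | 1 ≤ |x|}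
      ≤ P.real (A n) := by
    intro n
    obtain ⟨S, hS, hSY⟩ := hY.toIsPreBrownianReal.exists_isGaussianWalk ((2 ^ n : ℕ) : ℝ≥0)⁻¹
    have h1 := hS.le_measureReal_stayIn ha (by linarith) (2 ^ n)
    have h2 : ((2 ^ n : ℕ) : ℝ) * ((((2 ^ n : ℕ) : ℝ≥0)⁻¹ : ℝ≥0) : ℝ) = 1 := by
      rw [NNReal.coe_inv, NNReal.coe_natCast]
      exact mul_inv_cancel₀ (by positivity)
    rw [h2, mul_one] at h1
    refine h1.trans (ENNReal.toReal_mono (measure_ne_top _ _) (measure_mono_ae ?_))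
    filter_upwards [hSY] with ω hω h i hi
    rw [← hω]
    exact h i hi
  have hlimE := (IsPreBrownianReal.tendsto_mul_gaussianReal_tail one_pos).comp
    (tendsto_pow_atTop_atTop_of_one_lt (α := ℕ) one_lt_two)
  have hfin := le_of_tendsto_of_tendsto' (hlimE.const_sub
    (Real.exp (-(Real.pi ^ 2 / 2)) * Real.sin (Real.pi * a))) hlimA' hbound
  rw [sub_zero] at hfin
  have hsin : 2 * a ≤ Real.sin (Real.pi * a) := by
    have hpi := Real.pi_pos
    have := Real.mul_le_sin (x := Real.pi * a) (by positivity) (by nlinarith)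
    rwa [← mul_assoc, div_mul_cancel₀ _ hpi.ne'] at this
  refine le_trans (by gcongr) (hfin.trans ?_)
  refine ENNReal.toReal_mono (measure_ne_top _ _) (measure_mono_ae ?_)
  filter_upwards [hY.cont] with ω hω h s hs
  have hpow : Tendsto (fun n : ℕ => ((2 ^ n : ℕ) : ℝ≥0)) atTop atTop :=
    tendsto_natCast_atTop_atTop.comp (tendsto_pow_atTop_atTop_of_one_lt one_lt_two)
  have hfl : Tendsto (fun n : ℕ => (⌊s * ((2 ^ n : ℕ) : ℝ≥0)⌋₊ : ℝ≥0) / ((2 ^ n : ℕ) : ℝ≥0)) atTop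
      (nhds s) := by
    have : Tendsto (fun x : ℝ≥0 => (⌊s * x⌋₊ : ℝ≥0) / x) atTop (nhds s) := by
      rw [← NNReal.tendsto_coe]
      have h1 := (tendsto_nat_floor_mul_div_atTop s.coe_nonneg).comp
        (NNReal.tendsto_coe_atTop.2 tendsto_id)
      refine h1.congr fun x => ?_
      have h2 : ⌊(s : ℝ) * x⌋₊ = ⌊s * x⌋₊ := Nonneg.nat_floor_coe (s * x)
      simp [h2]
    exact this.comp hpow
  have hlimY := (hω.tendsto s).comp hfl
  have hmem : ∀ n : ℕ, Y ((⌊s * ((2 ^ n : ℕ) : ℝ≥0)⌋₊ : ℝ≥0) / ((2 ^ n : ℕ) : ℝ≥0)) ω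
      ∈ Set.Icc (-a) (1 - a) := by
    intro n
    have := Set.mem_iInter.1 h n ⌊s * ((2 ^ n : ℕ) : ℝ≥0)⌋₊ (Nat.floor_le_of_le (mul_le_of_le_one_left' hs))
    rw [div_eq_mul_inv]
    exact Set.Ioo_subset_Icc_self this
  exact isClosed_Icc.mem_of_tendsto hlimY (Eventually.of_forall hmem)

end ProbabilityTheory.IsBrownianReal

/-! ### Reflection, Brownian scaling and confinement up to time t -/

namespace ProbabilityTheory.IsBrownianReal

lemma measureReal_confined_neg {Ω : Type*} [MeasurableSpace Ω] {P : Measure Ω}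
    {Y : ℝ≥0 → Ω → ℝ} (t : ℝ≥0) (a b : ℝ) :
    P.real (confined (-Y) t a b) = P.real (confined Y t b a) := by
  congr 1
  ext ω
  refine forall_congr' fun s => imp_congr_right fun _ => ?_
  simp only [Pi.neg_apply, neg_le_neg_iff]
  rw [and_comm, neg_le]

lemma confined_scale {Ω : Type*} {Y : ℝ≥0 → Ω → ℝ} {t : ℝ≥0} (ht : t ≠ 0) (a b : ℝ) :
    confined Y t a b
      = confined (fun s ω => (√(t : ℝ))⁻¹ * Y (t * s) ω) 1 (a / √t) (b / √t) := by
  have hst : 0 < √(t : ℝ) := Real.sqrt_pos.2 (by exact_mod_cast pos_of_ne_zero ht)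
  have key : ∀ y : ℝ, (-a ≤ y ∧ y ≤ b)
      ↔ (-(a / √(t : ℝ)) ≤ (√(t : ℝ))⁻¹ * y ∧ (√(t : ℝ))⁻¹ * y ≤ b / √(t : ℝ)) := by
    intro y
    rw [← neg_div, inv_mul_eq_div, div_le_div_iff_of_pos_right hst,
      div_le_div_iff_of_pos_right hst]
  ext ω
  constructor
  · intro h s hs
    exact (key _).1 (h (t * s) (mul_le_of_le_one_right' hs))
  · intro h s hs
    have := h (t⁻¹ * s) (by rw [inv_mul_le_iff₀ (pos_of_ne_zero ht)]; simpa using hs)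
    simp only [mul_inv_cancel_left₀ ht] at this
    exact (key _).2 this

/-- The sum of two terms covers both orderings of the end points, reflection exchanging their roles.
The constant must be uniform over processes, since the bound at time one is applied to rescaled and
reflected motions. -/
lemma exists_measureReal_confined_le (K : ℕ) : ∃ C : ℝ, 0 < C ∧
    ∀ {Ω : Type*} [MeasurableSpace Ω] (P : Measure Ω) [IsProbabilityMeasure P] (Y : ℝ≥0 → Ω → ℝ),
      IsBrownianReal Y P → ∀ t : ℝ≥0, t ≠ 0 → ∀ a b : ℝ, 0 < a → 0 < b →
      P.real (confined Y t a b) ≤ C * (min 1 (a / √t) * min 1 ((b / √t) ^ (2 * K))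
        + min 1 (b / √t) * min 1 ((a / √t) ^ (2 * K))) := by
  obtain ⟨C, hC, h⟩ := IsPreBrownianReal.exists_measureReal_confined_le K
  refine ⟨C, hC, ?_⟩
  intro Ω _ P _ Y hY t ht a b ha hb
  have hst : 0 < √(t : ℝ) := Real.sqrt_pos.2 (by exact_mod_cast pos_of_ne_zero ht)
  have n1 : 0 ≤ min 1 (a / √(t : ℝ)) * min 1 ((b / √(t : ℝ)) ^ (2 * K)) := by positivity
  have n2 : 0 ≤ min 1 (b / √(t : ℝ)) * min 1 ((a / √(t : ℝ)) ^ (2 * K)) := by positivity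
  rcases le_total a b with hab | hab
  · rw [confined_scale ht]
    have := h P _ (hY.smul ht).toIsPreBrownianReal (a / √t) (b / √t) (by positivity) (by gcongr)
    nlinarith
  · rw [← measureReal_confined_neg, confined_scale ht]
    have := h P _ (hY.neg.smul ht).toIsPreBrownianReal (b / √t) (a / √t) (by positivity)
      (by gcongr)
    nlinarith

/-- After scaling to time one, the interval contains [-a, 1 - a] if `a ≤ 1/2`, and [-1/2, 1/2]
otherwise. -/
lemma le_measureReal_confined {Ω : Type*} [MeasurableSpace Ω] {P : Measure Ω}
    [IsProbabilityMeasure P] {Y : ℝ≥0 → Ω → ℝ} (hY : IsBrownianReal Y P) {t : ℝ≥0} (ht : t ≠ 0)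
    {a b : ℝ} (ha : 0 < a) (hb : √t ≤ b) :
    Real.exp (-(Real.pi ^ 2 / 2)) * min 1 (a / √t) ≤ P.real (confined Y t a b) := by
  have hst : 0 < √(t : ℝ) := Real.sqrt_pos.2 (by exact_mod_cast pos_of_ne_zero ht)
  rw [confined_scale ht]
  have hY' := hY.smul ht
  have hb' : 1 ≤ b / √(t : ℝ) := (one_le_div hst).2 hb
  have ha' : 0 < a / √(t : ℝ) := by positivity
  generalize a / √(t : ℝ) = a at *
  generalize b / √(t : ℝ) = b at *
  rcases le_or_gt a (1 / 2) with h | h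
  · calc _ ≤ Real.exp (-(Real.pi ^ 2 / 2)) * (2 * a) := by
          gcongr
          exact (min_le_right _ _).trans (by linarith)
      _ ≤ _ := hY'.le_measureReal_confined_one ha' h
      _ ≤ _ := by
          refine measureReal_mono fun ω hω s hs => ?_
          exact ⟨(hω s hs).1, (hω s hs).2.trans (by linarith)⟩
  · calc _ ≤ Real.exp (-(Real.pi ^ 2 / 2)) * (2 * (1 / 2)) := by
          gcongr
          exact (min_le_left _ _).trans (by linarith)
      _ ≤ _ := hY'.le_measureReal_confined_one (by norm_num) le_rfl
      _ ≤ _ := by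
          refine measureReal_mono fun ω hω s hs => ?_
          exact ⟨(by linarith : -a ≤ -(1 / 2)).trans (hω s hs).1, (hω s hs).2.trans (by linarith)⟩

end ProbabilityTheory.IsBrownianReal

/-! ### Truncated moments of a law with a power tail -/

/-- The truncated moment `E min(1, (ξ / T) ^ κ)` of a law on the real line. -/
noncomputable def truncMoment (μ : Measure ℝ) (κ : ℕ) (T : ℝ) : ℝ≥0∞ :=
  ∫⁻ x, ENNReal.ofReal (min 1 ((x / T) ^ κ)) ∂μ

/-- `f` is comparable to `x ^ (-p - 1)` on `[x₀, ∞)`. -/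
structure HasPowerTail (f : ℝ → ℝ) (p c D x₀ : ℝ) : Prop where
  one_le : 1 ≤ x₀
  p_pos : 0 < p
  c_pos : 0 < c
  D_pos : 0 < D
  lower : ∀ x, x₀ ≤ x → c * x ^ (-p - 1) ≤ f x
  upper : ∀ x, x₀ ≤ x → f x ≤ D * x ^ (-p - 1)

lemma SimAtTop.exists_hasPowerTail {f : ℝ → ℝ} {C p : ℝ} (hC : 0 < C) (hp : 0 < p)
    (h : SimAtTop f (fun t => C * t ^ (-p - 1))) :
    ∃ x₀, HasPowerTail f p (C / 2) (2 * C) x₀ := by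
  have h1 : ∀ᶠ t in atTop, 1 / 2 < f t / (C * t ^ (-p - 1)) := h.eventually_const_lt (by norm_num)
  have h2 : ∀ᶠ t in atTop, f t / (C * t ^ (-p - 1)) < 2 := h.eventually_lt_const (by norm_num)
  obtain ⟨x₀, hx₀⟩ := eventually_atTop.1 (h1.and (h2.and (eventually_ge_atTop 1)))
  have hpos : ∀ x, x₀ ≤ x → 0 < C * x ^ (-p - 1) := fun x hx =>
    mul_pos hC (Real.rpow_pos_of_pos (zero_lt_one.trans_le (hx₀ x hx).2.2) _)
  refine ⟨x₀, (hx₀ x₀ le_rfl).2.2, hp, by positivity, by positivity, fun x hx => ?_, fun x hx => ?_⟩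
  · have := (lt_div_iff₀ (hpos x hx)).1 (hx₀ x hx).1
    linarith
  · have := (div_lt_iff₀ (hpos x hx)).1 (hx₀ x hx).2.1
    linarith

namespace HasPowerTail

variable {f : ℝ → ℝ} {p c D x₀ : ℝ} {μ : Measure ℝ}

lemma lintegral_tail (hp : 0 < p) {T C : ℝ} (hT : 0 < T) (hC : 0 ≤ C) :
    ∫⁻ x in Set.Ioi T, ENNReal.ofReal (C * x ^ (-p - 1))
      = ENNReal.ofReal (C / p * T ^ (-p)) := by
  rw [← ofReal_integral_eq_lintegral_ofReal, integral_const_mul, integral_Ioi_rpow_of_lt _ hT]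
  · congr 1
    rw [sub_add_cancel, neg_div_neg_eq]; ring
  · linarith
  · exact (integrableOn_Ioi_rpow_of_lt (by linarith) hT).const_mul C
  · filter_upwards [ae_restrict_mem measurableSet_Ioi] with x hx
    have : 0 < x := hT.trans hx
    positivity

lemma measure_Ioi_le (hf : HasPowerTail f p c D x₀)
    (hμ : μ = volume.withDensity fun x => ENNReal.ofReal (f x)) {T : ℝ} (hT : x₀ ≤ T) :
    μ (Set.Ioi T) ≤ ENNReal.ofReal (D / p * T ^ (-p)) := by
  have hT0 : 0 < T := zero_lt_one.trans_le (hf.one_le.trans hT)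
  rw [hμ, withDensity_apply _ measurableSet_Ioi, ← lintegral_tail hf.p_pos hT0 hf.D_pos.le]
  exact setLIntegral_mono' measurableSet_Ioi fun x hx =>
    ENNReal.ofReal_le_ofReal (hf.upper x (hT.trans (le_of_lt hx)))

lemma le_measure_Ioi (hf : HasPowerTail f p c D x₀)
    (hμ : μ = volume.withDensity fun x => ENNReal.ofReal (f x)) {T : ℝ} (hT : x₀ ≤ T) :
    ENNReal.ofReal (c / p * T ^ (-p)) ≤ μ (Set.Ioi T) := by
  have hT0 : 0 < T := zero_lt_one.trans_le (hf.one_le.trans hT)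
  rw [hμ, withDensity_apply _ measurableSet_Ioi, ← lintegral_tail hf.p_pos hT0 hf.c_pos.le]
  exact setLIntegral_mono' measurableSet_Ioi fun x hx =>
    ENNReal.ofReal_le_ofReal (hf.lower x (hT.trans (le_of_lt hx)))

lemma lintegral_middle {C a b r : ℝ} (ha : 0 < a) (hab : a ≤ b) (hC : 0 ≤ C) :
    ∫⁻ x in Set.Ioc a b, ENNReal.ofReal (C * x ^ r)
      = ENNReal.ofReal (C * ∫ x in a..b, x ^ r) := by
  rw [intervalIntegral.integral_of_le hab, ← integral_const_mul,
    ofReal_integral_eq_lintegral_ofReal]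
  · refine Integrable.const_mul ?_ C
    have := intervalIntegral.intervalIntegrable_rpow (μ := volume) (a := a) (b := b) (r := r)
      (Or.inr (Set.notMem_uIcc_of_lt ha (ha.trans_le hab)))
    exact (intervalIntegrable_iff_integrableOn_Ioc_of_le hab).1 this
  · filter_upwards [ae_restrict_mem measurableSet_Ioc] with x hx
    have : 0 < x := ha.trans hx.1
    positivity

lemma mul_rpow_mul_div_pow {x T : ℝ} (hx : 0 < x) (hT : 0 < T) (κ : ℕ) (C p : ℝ) :
    C * x ^ (-p - 1) * (x / T) ^ κ = C * T ^ (-(κ : ℝ)) * x ^ ((κ : ℝ) - p - 1) := by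
  rw [div_pow, Real.rpow_neg hT.le, Real.rpow_natCast, show (κ : ℝ) - p - 1 = (-p - 1) + κ by ring,
    Real.rpow_add hx, Real.rpow_natCast]
  field_simp

/-- The three terms come from splitting at `x₀` and `T`: below `x₀` nothing is known about the
density, between them the power counts, and above `T` the truncation does. -/
lemma truncMoment_le [IsProbabilityMeasure μ] (hf : HasPowerTail f p c D x₀)
    (hf_meas : Measurable f)
    (hμ : μ = volume.withDensity fun x => ENNReal.ofReal (f x)) (hpos : ∀ᵐ x ∂μ, 0 < x)
    {T : ℝ} (hT : x₀ ≤ T) (κ : ℕ) :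
    truncMoment μ κ T ≤ ENNReal.ofReal ((x₀ / T) ^ κ)
      + ENNReal.ofReal (D * T ^ (-(κ : ℝ)) * ∫ x in x₀..T, x ^ ((κ : ℝ) - p - 1))
      + ENNReal.ofReal (D / p * T ^ (-p)) := by
  have hx0 : 0 < x₀ := zero_lt_one.trans_le hf.one_le
  have hT0 : 0 < T := hx0.trans_le hT
  have hg : Measurable fun x : ℝ => ENNReal.ofReal (min 1 ((x / T) ^ κ)) := by fun_prop
  have hsplit : truncMoment μ κ T
      ≤ ∫⁻ x in Set.Iic x₀, ENNReal.ofReal (min 1 ((x / T) ^ κ)) ∂μ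
        + ∫⁻ x in Set.Ioc x₀ T, ENNReal.ofReal (min 1 ((x / T) ^ κ)) ∂μ
        + ∫⁻ x in Set.Ioi T, ENNReal.ofReal (min 1 ((x / T) ^ κ)) ∂μ := by
    rw [truncMoment, ← setLIntegral_univ]
    refine le_trans (lintegral_mono_set ?_) ((lintegral_union_le _ _ _).trans
      (add_le_add_left (lintegral_union_le _ _ _) _))
    intro x _
    rcases le_or_gt x x₀ with h | h
    · exact Or.inl (Or.inl h)
    rcases le_or_gt x T with h' | h'
    · exact Or.inl (Or.inr ⟨h, h'⟩)
    · exact Or.inr h'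
  refine hsplit.trans (add_le_add (add_le_add ?_ ?_) ?_)
  · calc _ ≤ ∫⁻ x in Set.Iic x₀, ENNReal.ofReal ((x₀ / T) ^ κ) ∂μ := by
          refine setLIntegral_mono_ae' measurableSet_Iic ?_
          filter_upwards [hpos] with x hx hx'
          refine ENNReal.ofReal_le_ofReal ((min_le_right _ _).trans ?_)
          have : x ≤ x₀ := hx'
          gcongr
      _ ≤ _ := by
          rw [setLIntegral_const]
          exact mul_le_of_le_one_right' prob_le_one
  · rw [hμ, restrict_withDensity measurableSet_Ioc,
      lintegral_withDensity_eq_lintegral_mul _ (by fun_prop) hg,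
      ← lintegral_middle hx0 hT (by have := hf.D_pos; positivity)]
    refine setLIntegral_mono' measurableSet_Ioc fun x hx => ?_
    have hx' : 0 < x := hx0.trans hx.1
    rw [Pi.mul_apply, ← mul_rpow_mul_div_pow hx' hT0, ENNReal.ofReal_mul (by
      have := hf.D_pos; positivity)]
    gcongr
    · exact hf.upper x hx.1.le
    · exact min_le_right _ _
  · refine le_trans ?_ (hf.measure_Ioi_le hμ hT)
    rw [← setLIntegral_one]
    exact setLIntegral_mono' measurableSet_Ioi fun x _ => by
      rw [← ENNReal.ofReal_one]; exact ENNReal.ofReal_le_ofReal (min_le_left _ _)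

lemma le_truncMoment_one (hf : HasPowerTail f p c D x₀) (hf_meas : Measurable f)
    (hμ : μ = volume.withDensity fun x => ENNReal.ofReal (f x)) {T : ℝ} (hT : x₀ ≤ T) :
    ENNReal.ofReal (c * T ^ (-1 : ℝ) * ∫ x in x₀..T, x ^ (-p)) ≤ truncMoment μ 1 T := by
  have hx0 : 0 < x₀ := zero_lt_one.trans_le hf.one_le
  have hT0 : 0 < T := hx0.trans_le hT
  have hg : Measurable fun x : ℝ => ENNReal.ofReal (min 1 ((x / T) ^ 1)) := by fun_prop
  refine le_trans ?_ (setLIntegral_le_lintegral (Set.Ioc x₀ T) _)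
  rw [hμ, restrict_withDensity measurableSet_Ioc,
    lintegral_withDensity_eq_lintegral_mul _ (by fun_prop) hg,
    ← lintegral_middle hx0 hT (by have := hf.c_pos; positivity)]
  refine setLIntegral_mono' measurableSet_Ioc fun x hx => ?_
  have hx' : 0 < x := hx0.trans hx.1
  have e := mul_rpow_mul_div_pow hx' hT0 1 c p
  rw [Nat.cast_one, show (1 : ℝ) - p - 1 = -p by ring] at e
  rw [Pi.mul_apply, ← e, ENNReal.ofReal_mul (by have := hf.c_pos; positivity)]
  gcongr
  · exact hf.lower x hx.1.le
  · rw [le_min_iff]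
    refine ⟨?_, le_rfl⟩
    rw [pow_one]
    exact div_le_one_of_le₀ hx.2 hT0.le

lemma measure_Ioi_le_truncMoment {T : ℝ} (hT : 0 < T) (κ : ℕ) :
    μ (Set.Ioi T) ≤ truncMoment μ κ T := by
  rw [← setLIntegral_one]
  refine le_trans ?_ (setLIntegral_le_lintegral (Set.Ioi T) _)
  refine setLIntegral_mono' measurableSet_Ioi fun x hx => ?_
  rw [min_eq_left (one_le_pow₀ ((one_le_div hT).2 (le_of_lt hx))), ENNReal.ofReal_one]

lemma truncMoment_ne_top [IsProbabilityMeasure μ] (κ : ℕ) (T : ℝ) : truncMoment μ κ T ≠ ⊤ := by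
  refine ne_top_of_le_ne_top ENNReal.one_ne_top ?_
  calc truncMoment μ κ T ≤ ∫⁻ _, 1 ∂μ := lintegral_mono fun x => by
        rw [← ENNReal.ofReal_one]; exact ENNReal.ofReal_le_ofReal (min_le_left _ _)
    _ = 1 := by simp

/-- Pointwise, min(1, x)/T is at most min(1, x/T) for `T ≥ 1`. This gives the lower bound of order
1/T, which is sharp for p > 1. -/
lemma truncMoment_one_scale [IsProbabilityMeasure μ] {T : ℝ} (hT : 1 ≤ T) :
    ENNReal.ofReal ((truncMoment μ 1 1).toReal * T ^ (-1 : ℝ)) ≤ truncMoment μ 1 T := by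
  have hT0 : 0 < T := zero_lt_one.trans_le hT
  rw [ENNReal.ofReal_mul ENNReal.toReal_nonneg, ENNReal.ofReal_toReal (truncMoment_ne_top 1 1),
    truncMoment, ← lintegral_mul_const _ (by fun_prop)]
  refine lintegral_mono fun x => ?_
  rw [← ENNReal.ofReal_mul' (by positivity)]
  refine ENNReal.ofReal_le_ofReal ?_
  rw [Real.rpow_neg_one, pow_one, pow_one, div_one, ← div_eq_mul_inv]
  refine le_min (div_le_one_of_le₀ ((min_le_left _ _).trans hT) hT0.le) ?_
  gcongr
  exact min_le_right _ _

lemma truncMoment_one_one_pos [IsProbabilityMeasure μ] (hpos : ∀ᵐ x ∂μ, 0 < x) : 0 < (truncMoment μ 1 1).toReal := by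
  refine ENNReal.toReal_pos (fun h => ?_) (truncMoment_ne_top 1 1)
  rw [truncMoment, lintegral_eq_zero_iff (by fun_prop)] at h
  have : ∀ᵐ x ∂μ, False := by
    filter_upwards [h, hpos] with x h1 h2
    simp only [pow_one, div_one, Pi.zero_apply, ENNReal.ofReal_eq_zero, min_le_iff] at h1
    rcases h1 with h1 | h1 <;> linarith
  rw [eventually_false_iff_eq_bot, ae_eq_bot] at this
  exact IsProbabilityMeasure.ne_zero μ this

/-- For κ > p the middle integral is dominated by its upper end, so the moment is of the order of
the tail. This serves both the high moment and the case p < 1. -/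
lemma exists_truncMoment_le_of_lt [IsProbabilityMeasure μ] (hf : HasPowerTail f p c D x₀)
    (hf_meas : Measurable f)
    (hμ : μ = volume.withDensity fun x => ENNReal.ofReal (f x)) (hpos : ∀ᵐ x ∂μ, 0 < x)
    {κ : ℕ} (hκ : p < κ) :
    ∃ M : ℝ, 0 < M ∧ ∀ T, x₀ ≤ T → truncMoment μ κ T ≤ ENNReal.ofReal (M * T ^ (-p)) := by
  have hx0 : 0 < x₀ := zero_lt_one.trans_le hf.one_le
  have hD := hf.D_pos
  have hp := hf.p_pos
  have hκp : 0 < (κ : ℝ) - p := sub_pos.2 hκ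
  refine ⟨x₀ ^ κ + D / (κ - p) + D / p, by positivity, fun T hT => ?_⟩
  have hT0 : 0 < T := hx0.trans_le hT
  have hT1 : 1 ≤ T := hf.one_le.trans hT
  refine (hf.truncMoment_le hf_meas hμ hpos hT κ).trans ?_
  rw [add_mul, add_mul, ENNReal.ofReal_add (by positivity) (by positivity),
    ENNReal.ofReal_add (by positivity) (by positivity)]
  refine add_le_add (add_le_add (ENNReal.ofReal_le_ofReal ?_) (ENNReal.ofReal_le_ofReal ?_))
    (ENNReal.ofReal_le_ofReal ?_)
  · rw [div_pow, div_eq_mul_inv, ← Real.rpow_natCast T, ← Real.rpow_neg hT0.le]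
    gcongr
  · rw [integral_rpow (Or.inl (by linarith)), sub_add_cancel]
    have h1 : (T ^ ((κ : ℝ) - p) - x₀ ^ ((κ : ℝ) - p)) / (κ - p) ≤ T ^ ((κ : ℝ) - p) / (κ - p) := by
      gcongr
      have : 0 ≤ x₀ ^ ((κ : ℝ) - p) := by positivity
      linarith
    have h2 : T ^ (-p) = T ^ (-(κ : ℝ)) * T ^ ((κ : ℝ) - p) := by
      rw [← Real.rpow_add hT0]; congr 1; ring
    calc _ ≤ D * T ^ (-(κ : ℝ)) * (T ^ ((κ : ℝ) - p) / (κ - p)) := by gcongr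
      _ = _ := by rw [h2]; ring
  · exact le_rfl

/-- Here the middle integral stays bounded as `T` grows, its main contribution coming from the end
`x₀`. -/
lemma exists_truncMoment_one_le_of_one_lt [IsProbabilityMeasure μ]
    (hf : HasPowerTail f p c D x₀) (hf_meas : Measurable f)
    (hμ : μ = volume.withDensity fun x => ENNReal.ofReal (f x)) (hpos : ∀ᵐ x ∂μ, 0 < x)
    (hp1 : 1 < p) :
    ∃ M : ℝ, 0 < M ∧ ∀ T, x₀ ≤ T → truncMoment μ 1 T ≤ ENNReal.ofReal (M * T ^ (-1 : ℝ)) := by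
  have hx0 : 0 < x₀ := zero_lt_one.trans_le hf.one_le
  have hD := hf.D_pos
  have hp := hf.p_pos
  have hp1' : 0 < p - 1 := sub_pos.2 hp1
  refine ⟨x₀ + D * (x₀ ^ (1 - p) / (p - 1)) + D / p, by positivity, fun T hT => ?_⟩
  have hT0 : 0 < T := hx0.trans_le hT
  have hT1 : 1 ≤ T := hf.one_le.trans hT
  refine (hf.truncMoment_le hf_meas hμ hpos hT 1).trans ?_
  rw [add_mul, add_mul, ENNReal.ofReal_add (by positivity) (by positivity),
    ENNReal.ofReal_add (by positivity) (by positivity)]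
  refine add_le_add (add_le_add (ENNReal.ofReal_le_ofReal ?_) (ENNReal.ofReal_le_ofReal ?_))
    (ENNReal.ofReal_le_ofReal ?_)
  · rw [pow_one, Real.rpow_neg_one, div_eq_mul_inv]
  · rw [Nat.cast_one, integral_rpow (Or.inr ⟨by linarith, Set.notMem_uIcc_of_lt hx0 hT0⟩),
      sub_add_cancel, mul_right_comm]
    have h1 : (T ^ (1 - p) - x₀ ^ (1 - p)) / (1 - p) ≤ x₀ ^ (1 - p) / (p - 1) := by
      rw [← neg_div_neg_eq, neg_sub, neg_sub]
      have : 0 ≤ T ^ (1 - p) := by positivity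
      gcongr
      linarith
    gcongr
  · gcongr

lemma integral_rpow_neg_one {a b : ℝ} (ha : 0 < a) (hb : 0 < b) :
    ∫ x in a..b, x ^ (-1 : ℝ) = Real.log b - Real.log a := by
  simp only [Real.rpow_neg_one]
  rw [integral_inv_of_pos ha hb, Real.log_div hb.ne' ha.ne']

lemma exists_truncMoment_one_le_of_eq_one [IsProbabilityMeasure μ]
    (hf : HasPowerTail f 1 c D x₀) (hf_meas : Measurable f)
    (hμ : μ = volume.withDensity fun x => ENNReal.ofReal (f x)) (hpos : ∀ᵐ x ∂μ, 0 < x) :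
    ∃ M : ℝ, 0 < M ∧ ∀ T, max x₀ (Real.exp 1) ≤ T →
      truncMoment μ 1 T ≤ ENNReal.ofReal (M * (T ^ (-1 : ℝ) * Real.log T)) := by
  have hx0 : 0 < x₀ := zero_lt_one.trans_le hf.one_le
  have hD := hf.D_pos
  refine ⟨x₀ + D + D, by positivity, fun T hT => ?_⟩
  rw [max_le_iff] at hT
  have hT0 : 0 < T := hx0.trans_le hT.1
  have hlog : 1 ≤ Real.log T := (Real.le_log_iff_exp_le hT0).2 hT.2
  refine (hf.truncMoment_le hf_meas hμ hpos hT.1 1).trans ?_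
  rw [add_mul, add_mul, ENNReal.ofReal_add (by positivity) (by positivity),
    ENNReal.ofReal_add (by positivity) (by positivity)]
  refine add_le_add (add_le_add (ENNReal.ofReal_le_ofReal ?_) (ENNReal.ofReal_le_ofReal ?_))
    (ENNReal.ofReal_le_ofReal ?_)
  · rw [pow_one, Real.rpow_neg_one, div_eq_mul_inv]
    gcongr
    exact le_mul_of_one_le_right (by positivity) hlog
  · rw [Nat.cast_one, sub_self, zero_sub, integral_rpow_neg_one hx0 hT0, mul_assoc]
    gcongr
    have : 0 ≤ Real.log x₀ := Real.log_nonneg hf.one_le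
    linarith
  · rw [div_one]
    gcongr
    exact le_mul_of_one_le_right (by positivity) hlog

lemma le_truncMoment_one_of_eq_one (hf : HasPowerTail f 1 c D x₀) (hf_meas : Measurable f)
    (hμ : μ = volume.withDensity fun x => ENNReal.ofReal (f x)) {T : ℝ} (hT : x₀ ^ 2 ≤ T) :
    ENNReal.ofReal (c / 2 * (T ^ (-1 : ℝ) * Real.log T)) ≤ truncMoment μ 1 T := by
  have hx0 : 0 < x₀ := zero_lt_one.trans_le hf.one_le
  have hc := hf.c_pos
  have hT' : x₀ ≤ T := le_trans (by nlinarith [hf.one_le]) hT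
  have hT0 : 0 < T := hx0.trans_le hT'
  refine le_trans (ENNReal.ofReal_le_ofReal ?_) (hf.le_truncMoment_one hf_meas hμ hT')
  rw [integral_rpow_neg_one hx0 hT0]
  -- From `T ≥ x₀²`: subtracting log x₀ loses at most half of log T.
  have h1 : 2 * Real.log x₀ ≤ Real.log T := by
    have := Real.log_le_log (by positivity) hT
    rwa [Real.log_pow, Nat.cast_two] at this
  calc _ = c * T ^ (-1 : ℝ) * (Real.log T / 2) := by ring
    _ ≤ _ := by gcongr; linarith

end HasPowerTail

/-! ### Exit times and confinement events -/

lemma mem_of_lt_exitTime {y : ℝ≥0 → ℝ} {I : Set ℝ} {t s : ℝ≥0} (h : (t : ℝ≥0∞) < exitTime y I)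
    (hs : s ≤ t) : y s ∈ I := by
  by_contra hcon
  have : exitTime y I ≤ s := sInf_le ⟨s, hcon, rfl⟩
  exact not_lt.2 (this.trans (by exact_mod_cast hs)) h

/-- Openness and continuity keep the path inside for a short while after `t`, which makes the
inequality strict. -/
lemma lt_exitTime_of_forall_mem {y : ℝ≥0 → ℝ} (hy : Continuous y) {I : Set ℝ} (hI : IsOpen I)
    {t : ℝ≥0} (h : ∀ s ≤ t, y s ∈ I) : (t : ℝ≥0∞) < exitTime y I := by
  have hmem : y ⁻¹' I ∈ nhds t := (hI.preimage hy).mem_nhds (h t le_rfl)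
  obtain ⟨u, htu, hu⟩ := exists_Ico_subset_of_mem_nhds hmem (exists_gt t)
  refine lt_of_lt_of_le (b := (u : ℝ≥0∞)) (by exact_mod_cast htu) (le_sInf ?_)
  rintro _ ⟨s, hs, rfl⟩
  have : u ≤ s := by
    by_contra! hsu
    rcases le_total s t with hst | hst
    · exact hs (h s hst)
    · exact hs (hu ⟨hst, hsu⟩)
  exact ENNReal.coe_le_coe.2 this

/-- Reduces confinement to countably many times, as needed for joint measurability in the path and
the end points. -/
lemma mem_confined_iff_denseSeq {Ω : Type*} {Y : ℝ≥0 → Ω → ℝ} {ω : Ω}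
    (hω : Continuous fun s => Y s ω) (t : ℝ≥0) (a b : ℝ) :
    ω ∈ confined Y t a b ↔ ∀ i : ℕ, -a ≤ Y (TopologicalSpace.denseSeq (Set.Iic t) i) ω ∧
      Y (TopologicalSpace.denseSeq (Set.Iic t) i) ω ≤ b := by
  refine ⟨fun h i => h _ (TopologicalSpace.denseSeq (Set.Iic t) i).2, fun h s hs => ?_⟩
  have hcl : IsClosed {s : Set.Iic t | -a ≤ Y s ω ∧ Y s ω ≤ b} :=
    (isClosed_le continuous_const (hω.comp continuous_subtype_val)).inter
      (isClosed_le (hω.comp continuous_subtype_val) continuous_const)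
  exact (TopologicalSpace.denseRange_denseSeq (Set.Iic t)).induction_on
    (p := fun s : Set.Iic t => -a ≤ Y s ω ∧ Y s ω ≤ b) ⟨s, hs⟩ hcl h

/-! ### Averaging over the random end points -/

section RandomInterval

variable {Ω : Type*} [MeasurableSpace Ω] {P : Measure Ω} [IsProbabilityMeasure P]
  {Y : ℝ≥0 → Ω → ℝ} {ξ₁ ξ₂ : Ω → ℝ} {μ : Measure ℝ} [IsProbabilityMeasure μ]

omit [IsProbabilityMeasure μ] in
-- Fubini for the independent end points and the path sampled at a dense sequence of times. The
-- factor `l` allows a shrunken interval in the lower bound.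
lemma measure_confined_random_eq_lintegral (hY : IsBrownianReal Y P) (h₁ : HasLaw ξ₁ μ P)
    (h₂ : HasLaw ξ₂ μ P) (h₁₂ : IndepFun ξ₁ ξ₂ P)
    (hξY : IndepFun (fun ω => (ξ₁ ω, ξ₂ ω)) (fun ω (s : ℝ≥0) => Y s ω) P) (t : ℝ≥0) (l : ℝ) :
    P {ω | ω ∈ confined Y t (l * ξ₁ ω) (l * ξ₂ ω)}
      = ∫⁻ x, P (confined Y t (l * x.1) (l * x.2)) ∂(μ.prod μ) := by
  let τ : ℕ → ℝ≥0 := fun i => TopologicalSpace.denseSeq (Set.Iic t) i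
  let Z : Ω → ℕ → ℝ := fun ω i => Y (τ i) ω
  have hZ : AEMeasurable Z P := aemeasurable_pi_lambda _ fun i => hY.aemeasurable (τ i)
  have hξ : AEMeasurable (fun ω => (ξ₁ ω, ξ₂ ω)) P := h₁.aemeasurable.prodMk h₂.aemeasurable
  have hind : IndepFun (fun ω => (ξ₁ ω, ξ₂ ω)) Z P :=
    hξY.comp (φ := id) (ψ := fun (w : ℝ≥0 → ℝ) (i : ℕ) => w (τ i)) measurable_id (by fun_prop)
  let E : Set ((ℝ × ℝ) × (ℕ → ℝ)) := {x | ∀ i, -(l * x.1.1) ≤ x.2 i ∧ x.2 i ≤ l * x.1.2}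
  have hE : MeasurableSet E := by
    simp only [E, Set.ofPred_forall, Set.ofPred_and]
    exact MeasurableSet.iInter fun i => (measurableSet_le (by fun_prop) (by fun_prop)).inter
      (measurableSet_le (by fun_prop) (by fun_prop))
  have hmap : P.map (fun ω => ((ξ₁ ω, ξ₂ ω), Z ω)) = (μ.prod μ).prod (P.map Z) := by
    rw [hind.map_prod_eq_prod_map_map hξ hZ,
      h₁₂.map_prod_eq_prod_map_map h₁.aemeasurable h₂.aemeasurable, h₁.map_eq, h₂.map_eq]
  have key : P {ω | ((ξ₁ ω, ξ₂ ω), Z ω) ∈ E}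
      = ∫⁻ x, P {ω | (x, Z ω) ∈ E} ∂(μ.prod μ) := by
    have h := Measure.map_apply_of_aemeasurable (hξ.prodMk hZ) hE
    rw [hmap, Measure.prod_apply hE] at h
    refine h.symm.trans (lintegral_congr fun x => ?_)
    exact Measure.map_apply_of_aemeasurable hZ (measurable_prodMk_left hE)
  refine Eq.trans (measure_congr ?_) (key.trans (lintegral_congr fun x => measure_congr ?_))
  · filter_upwards [hY.cont] with ω hω
    exact propext (mem_confined_iff_denseSeq hω t _ _)
  · filter_upwards [hY.cont] with ω hω
    exact propext (mem_confined_iff_denseSeq hω t _ _).symm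

lemma exitTail_eq_toReal (P : Measure Ω) (Y : ℝ≥0 → Ω → ℝ) (a b : Ω → ℝ) (t : ℝ) :
    exitTail P Y a b t = (P {ω | (t.toNNReal : ℝ≥0∞)
      < exitTime (fun s => Y s ω) (Set.Ioo (-a ω) (b ω))}).toReal := rfl

lemma exists_exitTail_le (K : ℕ) : ∃ C : ℝ, 0 < C ∧
    ∀ {Ω : Type*} [MeasurableSpace Ω] (P : Measure Ω) [IsProbabilityMeasure P]
      (Y : ℝ≥0 → Ω → ℝ) (ξ₁ ξ₂ : Ω → ℝ) (μ : Measure ℝ) [IsProbabilityMeasure μ],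
      IsBrownianReal Y P → HasLaw ξ₁ μ P → HasLaw ξ₂ μ P → IndepFun ξ₁ ξ₂ P →
      IndepFun (fun ω => (ξ₁ ω, ξ₂ ω)) (fun ω (s : ℝ≥0) => Y s ω) P →
      (∀ᵐ x ∂μ, 0 < x) → ∀ t : ℝ, 0 < t →
      exitTail P Y ξ₁ ξ₂ t
        ≤ C * ((truncMoment μ 1 √t).toReal * (truncMoment μ (2 * K) √t).toReal) := by
  obtain ⟨C, hC, hbound⟩ := IsBrownianReal.exists_measureReal_confined_le K
  refine ⟨2 * C, by positivity, ?_⟩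
  intro Ω _ P _ Y ξ₁ ξ₂ μ _ hY h₁ h₂ h₁₂ hξY hpos t ht
  have ht' : t.toNNReal ≠ 0 := (Real.toNNReal_pos.2 ht).ne'
  have hst : 0 < √t := Real.sqrt_pos.2 ht
  rw [exitTail_eq_toReal]
  have hJ1 := HasPowerTail.truncMoment_ne_top (μ := μ) 1 √t
  have hJK := HasPowerTail.truncMoment_ne_top (μ := μ) (2 * K) √t
  refine ENNReal.toReal_le_of_le_ofReal (by positivity) ?_
  have hw1 : AEMeasurable (fun x : ℝ => ENNReal.ofReal (min 1 ((x / √t) ^ 1))) μ := by fun_prop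
  have hwK : AEMeasurable (fun x : ℝ => ENNReal.ofReal (min 1 ((x / √t) ^ (2 * K)))) μ := by
    fun_prop
  calc P {ω | (t.toNNReal : ℝ≥0∞) < exitTime (fun s => Y s ω) (Set.Ioo (-ξ₁ ω) (ξ₂ ω))}
      ≤ P {ω | ω ∈ confined Y t.toNNReal (1 * ξ₁ ω) (1 * ξ₂ ω)} := by
        refine measure_mono fun ω hω s hs => ?_
        have := mem_of_lt_exitTime hω hs
        rw [one_mul, one_mul]
        exact ⟨this.1.le, this.2.le⟩
    _ = ∫⁻ x, P (confined Y t.toNNReal (1 * x.1) (1 * x.2)) ∂(μ.prod μ) :=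
        measure_confined_random_eq_lintegral hY h₁ h₂ h₁₂ hξY _ _
    _ ≤ ∫⁻ x, ENNReal.ofReal C *
          (ENNReal.ofReal (min 1 ((x.1 / √t) ^ 1)) * ENNReal.ofReal (min 1 ((x.2 / √t) ^ (2 * K)))
          + ENNReal.ofReal (min 1 ((x.1 / √t) ^ (2 * K))) * ENNReal.ofReal (min 1 ((x.2 / √t) ^ 1)))
          ∂(μ.prod μ) := by
        refine lintegral_mono_ae ?_
        have hp1 : ∀ᵐ x ∂(μ.prod μ), 0 < x.1 := Measure.quasiMeasurePreserving_fst.ae hpos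
        have hp2 : ∀ᵐ x ∂(μ.prod μ), 0 < x.2 := Measure.quasiMeasurePreserving_snd.ae hpos
        filter_upwards [hp1, hp2] with x hx1 hx2
        have h := hbound P Y hY _ ht' x.1 x.2 hx1 hx2
        rw [Real.coe_toNNReal _ ht.le] at h
        have m1 : 0 ≤ min 1 (x.1 / √t) := by positivity
        have m2 : 0 ≤ min 1 (x.2 / √t) := by positivity
        have m3 : 0 ≤ min 1 ((x.1 / √t) ^ (2 * K)) := by positivity
        rw [one_mul, one_mul, ← ofReal_measureReal, pow_one, pow_one, ← ENNReal.ofReal_mul m1,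
          ← ENNReal.ofReal_mul m3, ← ENNReal.ofReal_add (by positivity) (by positivity),
          ← ENNReal.ofReal_mul hC.le]
        refine ENNReal.ofReal_le_ofReal (h.trans (le_of_eq ?_))
        ring
    _ = ENNReal.ofReal C * (truncMoment μ 1 √t * truncMoment μ (2 * K) √t
          + truncMoment μ (2 * K) √t * truncMoment μ 1 √t) := by
        rw [lintegral_const_mul _ (by fun_prop), lintegral_add_left (by fun_prop),
          lintegral_prod_mul hw1 hwK, lintegral_prod_mul hwK hw1]
        rfl
    _ = ENNReal.ofReal (2 * C *
          ((truncMoment μ 1 √t).toReal * (truncMoment μ (2 * K) √t).toReal)) := by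
        rw [ENNReal.ofReal_mul (by positivity), ENNReal.ofReal_mul ENNReal.toReal_nonneg,
          ENNReal.ofReal_toReal hJ1, ENNReal.ofReal_toReal hJK, ENNReal.ofReal_mul (by norm_num),
          ENNReal.ofReal_ofNat]
        ring

/-- Confinement to the closed interval with halved end points implies staying in the open one. This
halving explains the constant 1/2 and the threshold `2√t`, above which `ξ₂/2` exceeds `√t`. -/
lemma le_exitTail (hY : IsBrownianReal Y P) (h₁ : HasLaw ξ₁ μ P) (h₂ : HasLaw ξ₂ μ P)
    (h₁₂ : IndepFun ξ₁ ξ₂ P)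
    (hξY : IndepFun (fun ω => (ξ₁ ω, ξ₂ ω)) (fun ω (s : ℝ≥0) => Y s ω) P)
    (hpos : ∀ᵐ x ∂μ, 0 < x) {t : ℝ} (ht : 0 < t) :
    Real.exp (-(Real.pi ^ 2 / 2)) / 2 * ((truncMoment μ 1 √t).toReal * μ.real (Set.Ioi (2 * √t)))
      ≤ exitTail P Y ξ₁ ξ₂ t := by
  have ht' : t.toNNReal ≠ 0 := (Real.toNNReal_pos.2 ht).ne'
  have hst : 0 < √t := Real.sqrt_pos.2 ht
  set c := Real.exp (-(Real.pi ^ 2 / 2)) / 2 with hc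
  have hc0 : 0 < c := by positivity
  rw [exitTail_eq_toReal]
  have hJ1 := HasPowerTail.truncMoment_ne_top (μ := μ) 1 √t
  rw [← ENNReal.ofReal_le_iff_le_toReal (measure_ne_top _ _)]
  have hw1 : AEMeasurable (fun x : ℝ => ENNReal.ofReal (min 1 ((x / √t) ^ 1))) μ := by fun_prop
  have hp1 : ∀ᵐ ω ∂P, 0 < ξ₁ ω := (h₁.ae_iff (by fun_prop)).2 hpos
  have hp2 : ∀ᵐ ω ∂P, 0 < ξ₂ ω := (h₂.ae_iff (by fun_prop)).2 hpos
  have hind : Measurable ((Set.Ioi (2 * √t)).indicator (1 : ℝ → ℝ≥0∞)) :=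
    measurable_one.indicator measurableSet_Ioi
  calc ENNReal.ofReal (c * ((truncMoment μ 1 √t).toReal * μ.real (Set.Ioi (2 * √t))))
      = ENNReal.ofReal c * (truncMoment μ 1 √t * μ (Set.Ioi (2 * √t))) := by
        rw [ENNReal.ofReal_mul hc0.le, ENNReal.ofReal_mul ENNReal.toReal_nonneg,
          ENNReal.ofReal_toReal hJ1, ofReal_measureReal]
    _ = ∫⁻ x, ENNReal.ofReal c * (ENNReal.ofReal (min 1 ((x.1 / √t) ^ 1))
          * (Set.Ioi (2 * √t)).indicator 1 x.2) ∂(μ.prod μ) := by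
        rw [lintegral_const_mul _ (by fun_prop), lintegral_prod_mul hw1 hind.aemeasurable,
          lintegral_indicator_one measurableSet_Ioi]
        rfl
    _ ≤ ∫⁻ x, P (confined Y t.toNNReal (1 / 2 * x.1) (1 / 2 * x.2)) ∂(μ.prod μ) := by
        refine lintegral_mono_ae ?_
        have hx1 : ∀ᵐ x ∂(μ.prod μ), 0 < x.1 := Measure.quasiMeasurePreserving_fst.ae hpos
        filter_upwards [hx1] with x hx1
        by_cases hx : x.2 ∈ Set.Ioi (2 * √t)
        · rw [Set.indicator_of_mem hx, Pi.one_apply, mul_one, ← ENNReal.ofReal_mul hc0.le,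
            ← ofReal_measureReal]
          refine ENNReal.ofReal_le_ofReal ?_
          have h := hY.le_measureReal_confined ht' (a := 1 / 2 * x.1) (b := 1 / 2 * x.2)
            (by positivity) (by
              rw [Real.coe_toNNReal _ ht.le]
              rw [Set.mem_Ioi] at hx
              linarith)
          rw [Real.coe_toNNReal _ ht.le] at h
          refine le_trans ?_ h
          rw [hc, div_mul_eq_mul_div, mul_div_assoc, pow_one]
          gcongr
          rw [le_min_iff]
          constructor
          · linarith [min_le_left 1 (x.1 / √t)]
          · rw [mul_div_assoc]
            linarith [min_le_right 1 (x.1 / √t)]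
        · rw [Set.indicator_of_notMem hx, mul_zero, mul_zero]
          exact zero_le
    _ = P {ω | ω ∈ confined Y t.toNNReal (1 / 2 * ξ₁ ω) (1 / 2 * ξ₂ ω)} :=
        (measure_confined_random_eq_lintegral hY h₁ h₂ h₁₂ hξY _ _).symm
    _ ≤ P {ω | (t.toNNReal : ℝ≥0∞)
          < exitTime (fun s => Y s ω) (Set.Ioo (-ξ₁ ω) (ξ₂ ω))} := by
        refine measure_mono_ae ?_
        filter_upwards [hY.cont, hp1, hp2] with ω hω h1 h2 h
        refine lt_exitTime_of_forall_mem hω isOpen_Ioo fun s hs => ?_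
        obtain ⟨hl, hu⟩ := h s hs
        constructor <;> linarith

/-- Isolates what depends on the regime: the order `g` of the first truncated moment. The other
factor is always of order √t^(-p), once 2K exceeds p. -/
lemma approxAtTop_exitTail {f : ℝ → ℝ} {p c D x₀ : ℝ} (hf : HasPowerTail f p c D x₀)
    (hf_meas : Measurable f) (hμ : μ = volume.withDensity fun x => ENNReal.ofReal (f x))
    (hpos : ∀ᵐ x ∂μ, 0 < x) (hY : IsBrownianReal Y P) (h₁ : HasLaw ξ₁ μ P) (h₂ : HasLaw ξ₂ μ P)
    (h₁₂ : IndepFun ξ₁ ξ₂ P)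
    (hξY : IndepFun (fun ω => (ξ₁ ω, ξ₂ ω)) (fun ω (s : ℝ≥0) => Y s ω) P)
    {g h : ℝ → ℝ} {m M T₀ d : ℝ} (hm : 0 < m) (hM : 0 < M) (hd : 0 < d)
    (hg : ∀ T, T₀ ≤ T → 0 < g T)
    (hlow : ∀ T, T₀ ≤ T → ENNReal.ofReal (m * g T) ≤ truncMoment μ 1 T)
    (hup : ∀ T, T₀ ≤ T → truncMoment μ 1 T ≤ ENNReal.ofReal (M * g T))
    (hh : ∀ t, 0 < t → h t = d * (g √t * √t ^ (-p))) :
    ApproxAtTop (exitTail P Y ξ₁ ξ₂) h := by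
  obtain ⟨K, hK⟩ := exists_nat_gt p
  obtain ⟨C, hC, hCbound⟩ := exists_exitTail_le K
  obtain ⟨M', hM', hM'bound⟩ := hf.exists_truncMoment_le_of_lt hf_meas hμ hpos (κ := 2 * K)
    (by push_cast; have := hf.p_pos; linarith)
  have hp := hf.p_pos
  have hc := hf.c_pos
  refine ⟨Real.exp (-(Real.pi ^ 2 / 2)) / 2 * (m * (c / p * 2 ^ (-p))) / d, C * (M * M') / d,
    by positivity, by positivity, ?_⟩
  have htend : Tendsto Real.sqrt atTop atTop := Real.tendsto_sqrt_atTop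
  filter_upwards [eventually_gt_atTop 0, htend.eventually_ge_atTop T₀,
    htend.eventually_ge_atTop x₀] with t ht hT0 hx0
  have hst : 0 < √t := Real.sqrt_pos.2 ht
  have hgT := hg _ hT0
  have hJ1 := HasPowerTail.truncMoment_ne_top (μ := μ) 1 √t
  have hht : 0 < h t := by rw [hh t ht]; positivity
  rw [le_div_iff₀ hht, div_le_iff₀ hht, hh t ht]
  constructor
  · refine le_trans ?_ (le_exitTail hY h₁ h₂ h₁₂ hξY hpos ht)
    have e1 : m * g √t ≤ (truncMoment μ 1 √t).toReal :=
      (ENNReal.ofReal_le_iff_le_toReal hJ1).1 (hlow _ hT0)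
    have e2 : c / p * (2 * √t) ^ (-p) ≤ μ.real (Set.Ioi (2 * √t)) :=
      (ENNReal.ofReal_le_iff_le_toReal (measure_ne_top _ _)).1
        (hf.le_measure_Ioi hμ (by linarith))
    rw [Real.mul_rpow (by norm_num) hst.le] at e2
    calc _ = Real.exp (-(Real.pi ^ 2 / 2)) / 2 * ((m * g √t) * (c / p * (2 ^ (-p) * √t ^ (-p)))) := by
          field_simp
      _ ≤ _ := by gcongr
  · refine (hCbound P Y ξ₁ ξ₂ μ hY h₁ h₂ h₁₂ hξY hpos t ht).trans ?_
    have e1 : (truncMoment μ 1 √t).toReal ≤ M * g √t :=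
      ENNReal.toReal_le_of_le_ofReal (by positivity) (hup _ hT0)
    have e2 : (truncMoment μ (2 * K) √t).toReal ≤ M' * √t ^ (-p) :=
      ENNReal.toReal_le_of_le_ofReal (by positivity) (hM'bound _ hx0)
    calc _ ≤ C * ((M * g √t) * (M' * √t ^ (-p))) := by gcongr
      _ = _ := by field_simp

end RandomInterval

/-! ### The three regimes -/

theorem theorem3p1
    {Ω₀ : Type*} [MeasurableSpace Ω₀] (P₀ : Measure Ω₀) [IsProbabilityMeasure P₀]
    {Ω : Type*} [MeasurableSpace Ω] (P : Measure Ω) [IsProbabilityMeasure P]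
    (ξ : Ω₀ → ℝ) (f : ℝ → ℝ) (C p : ℝ) (ξ₁ ξ₂ : Ω → ℝ) (Y : ℝ≥0 → Ω → ℝ)
    (hξ_pos : ∀ᵐ ω ∂P₀, 0 < ξ ω)
    (hf_meas : Measurable f) (hf_nonneg : ∀ x, 0 ≤ f x)
    (hξ_density : HasLaw ξ (volume.withDensity fun x => ENNReal.ofReal (f x)) P₀)
    (hC : 0 < C) (hp : 0 < p)
    (hf_tail : SimAtTop f (fun t => C * t ^ (-p - 1)))
    (hξ₁ : IdentDistrib ξ₁ ξ P P₀) (hξ₂ : IdentDistrib ξ₂ ξ P P₀)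
    (hξ₁ξ₂ : IndepFun ξ₁ ξ₂ P)
    (hY : IsBrownianReal Y P)
    (hξY : IndepFun (fun ω => (ξ₁ ω, ξ₂ ω)) (fun ω (s : ℝ≥0) => Y s ω) P) :
    (p < 1 → ApproxAtTop (exitTail P Y ξ₁ ξ₂) (fun t => t ^ (-p))) ∧
    (p = 1 → ApproxAtTop (exitTail P Y ξ₁ ξ₂) (fun t => t ^ (-1 : ℝ) * Real.log t)) ∧
    (1 < p → ApproxAtTop (exitTail P Y ξ₁ ξ₂) (fun t => t ^ (-(p + 1) / 2))) := by
  obtain ⟨μ, hμ⟩ : ∃ μ, μ = volume.withDensity fun x => ENNReal.ofReal (f x) := ⟨_, rfl⟩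
  rw [← hμ] at hξ_density
  have hprob : IsProbabilityMeasure μ := hξ_density.isProbabilityMeasure_iff.1 inferInstance
  have hpos : ∀ᵐ x ∂μ, 0 < x := (hξ_density.ae_iff (by fun_prop)).1 hξ_pos
  have h₁ : HasLaw ξ₁ μ P := hξ₁.symm.hasLaw hξ_density
  have h₂ : HasLaw ξ₂ μ P := hξ₂.symm.hasLaw hξ_density
  obtain ⟨x₀, hf⟩ := hf_tail.exists_hasPowerTail hC hp
  have hsqrt : ∀ t : ℝ, 0 < t → ∀ r s : ℝ, √t ^ r * √t ^ s = t ^ ((r + s) / 2) := by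
    intro t ht r s
    rw [← Real.rpow_add (Real.sqrt_pos.2 ht), Real.sqrt_eq_rpow, ← Real.rpow_mul ht.le]
    congr 1; ring
  refine ⟨fun hp1 => ?_, ?_, fun hp1 => ?_⟩
  · obtain ⟨M, hM, hup⟩ := hf.exists_truncMoment_le_of_lt hf_meas hμ hpos (κ := 1)
      (by rwa [Nat.cast_one])
    have hx0 : 0 < x₀ := zero_lt_one.trans_le hf.one_le
    refine approxAtTop_exitTail hf hf_meas hμ hpos hY h₁ h₂ hξ₁ξ₂ hξY (g := fun T => T ^ (-p))
      (m := C / 2 / p) (M := M) (T₀ := x₀) (d := 1) (by positivity) hM one_pos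
      (fun T hT => Real.rpow_pos_of_pos (hx0.trans_le hT) _) (fun T hT => ?_) hup fun t ht => ?_
    · exact (hf.le_measure_Ioi hμ hT).trans
        (HasPowerTail.measure_Ioi_le_truncMoment (hx0.trans_le hT) 1)
    · rw [one_mul, hsqrt t ht]; congr 1; ring
  · rintro rfl
    obtain ⟨M, hM, hup⟩ := hf.exists_truncMoment_one_le_of_eq_one hf_meas hμ hpos
    refine approxAtTop_exitTail hf hf_meas hμ hpos hY h₁ h₂ hξ₁ξ₂ hξY
      (g := fun T => T ^ (-1 : ℝ) * Real.log T)
      -- The factor `d = 2` converts log √t into log t; in `T₀`, the square serves the lower bound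
      -- and exp 1 the upper one.
      (m := C / 2 / 2) (M := M) (T₀ := max (x₀ ^ 2) (max x₀ (Real.exp 1))) (d := 2)
      (by positivity) hM two_pos (fun T hT => ?_)
      (fun T hT => hf.le_truncMoment_one_of_eq_one hf_meas hμ ((le_max_left _ _).trans hT))
      (fun T hT => hup T ((le_max_right _ _).trans hT)) fun t ht => ?_
    · have h1 : Real.exp 1 ≤ T := (le_max_right _ _).trans ((le_max_right _ _).trans hT)
      have h2 : 1 < T := lt_of_lt_of_le (Real.one_lt_exp_iff.2 one_pos) h1
      have := Real.log_pos h2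
      positivity
    · rw [mul_right_comm, hsqrt t ht, Real.log_sqrt ht.le,
        show ((-1 : ℝ) + -1) / 2 = -1 by norm_num]
      ring
  · obtain ⟨M, hM, hup⟩ := hf.exists_truncMoment_one_le_of_one_lt hf_meas hμ hpos hp1
    refine approxAtTop_exitTail hf hf_meas hμ hpos hY h₁ h₂ hξ₁ξ₂ hξY
      (g := fun T => T ^ (-1 : ℝ)) (m := (truncMoment μ 1 1).toReal) (M := M) (T₀ := x₀) (d := 1)
      (HasPowerTail.truncMoment_one_one_pos hpos) hM one_pos
      (fun T hT => Real.rpow_pos_of_pos (zero_lt_one.trans_le (hf.one_le.trans hT)) _)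
      (fun T hT => HasPowerTail.truncMoment_one_scale (hf.one_le.trans hT)) hup fun t ht => ?_
    rw [one_mul, hsqrt t ht]; congr 1; ring
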